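/- Let $p$ be a prime, $F$ a finite extension of $\mathbb{Q}_p$ with residue field of cardinality $q$, $\overline F$ an algebraic closure of $F$, $W_F$ the Weil group of $F$ and $I_F\subset W_F$ its inertia subgroup. For a finite-dimensional smooth complex representation $\tau$ of $W_F$ put $$L(s,\tau)=\det\bigl(1-q^{-s}\,\mathrm{Frob}\,\big|\,\tau^{I_F}\bigr)^{-1},$$ where $\mathrm{Frob}$ is a geometric Frobenius element (any choice). Let $\rho$ be a self-dual irreducible finite-dimensional smooth complex representation of $W_F$. Let $E/F$, $E\subset\overline F$, be a maximal unramified extension from which $\rho$ is induced; that is, $E/F$ is finite unramified, $\rho$ is induced from a finite-dimensional smooth representation of $W_E$, and $\rho$ is not induced from a finite-dimensional smooth representation of $W_{E'}$ for any finite unramified extension $E'/F$ in $\overline F$ strictly containing $E$. Let $d=[E:F]$ and let $\sigma$ be a finite-dimensional smooth complex representation of $W_E$ with $\rho\cong\mathrm{Ind}_{W_E}^{W_F}\sigma$. (1) Suppose that $\rho$ is orthogonal. If $\sigma$ is self-dual, then $L(s,\wedge^2\rho)=1$. If $\sigma$ is not self-dual, then $d$ is even, say $d=2e$, and $L(s,\wedge^2\rho)=(1+q^{-es})^{-1}$.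 (2) Suppose that $\rho$ is symplectic. If $\sigma$ is self-dual, then $L(s,\mathrm{Sym}^2\rho)=1$. If $\sigma$ is not self-dual, then $d$ is even, say $d=2e$, and $L(s,\mathrm{Sym}^2\rho)=(1+q^{-es})^{-1}$. -/

import Mathlib

open scoped NNReal TensorProduct

noncomputable section

namespace WeilRep

section Valuation

variable (p : ℕ) [Fact p.Prime]

/-- The absolute value of an algebraic extension `L` of `ℚ_p`: the unique one extending the `p`-adic
absolute value, given by Mathlib's spectral norm. -/
def absVal (L : Type*) [Field L] [Algebra ℚ_[p] L] [Algebra.IsAlgebraic ℚ_[p] L] :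
    Valuation L ℝ≥0 where
  toFun x := ⟨spectralNorm ℚ_[p] L x, spectralNorm_nonneg x⟩
  map_zero' := by ext; exact spectralNorm_zero (K := ℚ_[p]) (L := L)
  map_one' := by ext; exact spectralNorm_one (K := ℚ_[p]) (L := L)
  map_mul' x y := by
    ext
    exact map_mul (spectralMulAlgNorm ℚ_[p] L) x y
  map_add_le_max' x y :=
    isNonarchimedean_spectralNorm (K := ℚ_[p]) (L := L) x y

variable (F : Type*) [Field F] [Algebra ℚ_[p] F] [FiniteDimensional ℚ_[p] F]

instance isAlgebraic_algebraicClosure : Algebra.IsAlgebraic ℚ_[p] (AlgebraicClosure F) :=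
  Algebra.IsAlgebraic.trans ℚ_[p] F (AlgebraicClosure F)

/-- The number `q` of elements of the residue field of `F`. -/
def residueCard : ℕ := Nat.card (IsLocalRing.ResidueField (absVal p F).valuationSubring)

variable {F} in
lemma absVal_apply_aut (w : Gal(AlgebraicClosure F/F)) (x : AlgebraicClosure F) :
    absVal p (AlgebraicClosure F) (w x) = absVal p (AlgebraicClosure F) x := by
  ext
  exact (spectralNorm_eq_of_equiv (K := ℚ_[p]) (w.restrictScalars ℚ_[p]) x).symm

end Valuation

section WeilGroup

variable (p : ℕ) [Fact p.Prime] (F : Type*) [Field F] [Algebra ℚ_[p] F] [FiniteDimensional ℚ_[p] F]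

/-- The absolute Galois group of `F`. -/
abbrev AbsGal : Type _ := Gal(AlgebraicClosure F/F)

/-- The inertia subgroup: the automorphisms acting trivially on the residue field of the ring of
integers of `AlgebraicClosure F`. -/
def inertia : Subgroup (AbsGal F) where
  carrier := {w | ∀ x, absVal p (AlgebraicClosure F) x ≤ 1 →
    absVal p (AlgebraicClosure F) (w x - x) < 1}
  one_mem' x _ := by simp
  mul_mem' {a b} ha hb x hx := by
    have h1 := ha (b x) (by rwa [absVal_apply_aut])
    have h2 := hb x hx
    have : (a * b) x - x = (a (b x) - b x) + (b x - x) := by simp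
    rw [this]
    exact Valuation.map_add_lt _ h1 h2
  inv_mem' {a} ha x hx := by
    have h1 := ha (a⁻¹ x) (by rwa [absVal_apply_aut])
    rw [← AlgEquiv.mul_apply, mul_inv_cancel, AlgEquiv.one_apply] at h1
    rwa [Valuation.map_sub_swap]

instance inertia_normal : (inertia p F).Normal where
  conj_mem n hn g x hx := by
    have h1 := hn (g⁻¹ x) (by rwa [absVal_apply_aut])
    rw [← absVal_apply_aut p g, map_sub, ← AlgEquiv.mul_apply g g⁻¹, mul_inv_cancel,
      AlgEquiv.one_apply] at h1
    exact h1

variable {F} in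
/-- `w` acts as `x ↦ x ^ (q ^ n)` on the residue field of the ring of integers of
`AlgebraicClosure F`. -/
def ActsAsFrobPow (w : AbsGal F) (n : ℕ) : Prop :=
  ∀ x, absVal p (AlgebraicClosure F) x ≤ 1 →
    absVal p (AlgebraicClosure F) (w x - x ^ (residueCard p F ^ n)) < 1

section Closure

variable {p F} {w u : AbsGal F} {m n : ℕ}

lemma pow_sub_pow_lt {L : Type*} [Field L] (v : Valuation L ℝ≥0) {a b : L} (ha : v a ≤ 1)
    (hb : v b ≤ 1) (h : v (a - b) < 1) (k : ℕ) : v (a ^ k - b ^ k) < 1 := by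
  rw [← (Commute.all a b).geom_sum₂_mul, map_mul]
  refine mul_lt_one_of_nonneg_of_lt_one_right (Valuation.map_sum_le _ fun i _ => ?_) zero_le h
  rw [map_mul, map_pow, map_pow]
  exact mul_le_one' (pow_le_one' ha _) (pow_le_one' hb _)

lemma ActsAsFrobPow.mul (hw : ActsAsFrobPow p w n) (hu : ActsAsFrobPow p u m) :
    ActsAsFrobPow p (w * u) (m + n) := fun x hx => by
  have hux : absVal p (AlgebraicClosure F) (u x) ≤ 1 := by rwa [absVal_apply_aut]
  have h1 := hw (u x) hux
  have h2 := pow_sub_pow_lt _ hux (by rw [map_pow]; exact pow_le_one' hx _) (hu x hx)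
    (residueCard p F ^ n)
  rw [← pow_mul, ← pow_add] at h2
  have := Valuation.map_add_lt _ h1 h2
  rwa [sub_add_sub_cancel] at this

lemma ActsAsFrobPow.mul_inv (hw : ActsAsFrobPow p w n) (hu : ActsAsFrobPow p u m) (h : m ≤ n) :
    ActsAsFrobPow p (w * u⁻¹) (n - m) := fun x hx => by
  have hy : absVal p (AlgebraicClosure F) (u⁻¹ x) ≤ 1 := by rwa [absVal_apply_aut]
  have h1 := hw (u⁻¹ x) hy
  have h2 := hu (u⁻¹ x) hy
  rw [← AlgEquiv.mul_apply u, mul_inv_cancel, AlgEquiv.one_apply] at h2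
  have h3 := pow_sub_pow_lt _ hx (by rw [map_pow]; exact pow_le_one' hy _) h2
    (residueCard p F ^ (n - m))
  rw [← pow_mul, ← pow_add, Nat.add_sub_cancel' h, Valuation.map_sub_swap] at h3
  have := Valuation.map_add_lt _ h1 h3
  rwa [sub_add_sub_cancel] at this

lemma ActsAsFrobPow.inv_mul (hu : ActsAsFrobPow p u m) (hw : ActsAsFrobPow p w n) (h : m ≤ n) :
    ActsAsFrobPow p (u⁻¹ * w) (n - m) := fun x hx => by
  have h1 := hw x hx
  have h2 := hu (x ^ (residueCard p F ^ (n - m))) (by rw [map_pow]; exact pow_le_one' hx _)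
  rw [← pow_mul, ← pow_add, Nat.sub_add_cancel h, Valuation.map_sub_swap] at h2
  have h3 := Valuation.map_add_lt _ h1 h2
  rw [sub_add_sub_cancel, ← absVal_apply_aut p u⁻¹, map_sub, ← AlgEquiv.mul_apply u⁻¹ u,
    inv_mul_cancel, AlgEquiv.one_apply] at h3
  exact h3

end Closure

/-- The Weil group of `F`: the automorphisms that act on the residue field of the ring of integers
of `AlgebraicClosure F` as an integral power of the Frobenius automorphism `x ↦ x ^ q`. -/
def weilGroup : Subgroup (AbsGal F) where
  carrier := {w | ∃ n : ℕ, ActsAsFrobPow p w n ∨ ActsAsFrobPow p w⁻¹ n}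
  one_mem' := ⟨0, Or.inl fun x _ => by simp⟩
  mul_mem' {a b} := by
    rintro ⟨n, ha⟩ ⟨m, hb⟩
    rcases ha with ha | ha <;> rcases hb with hb | hb
    · exact ⟨_, Or.inl (ha.mul hb)⟩
    · rcases le_total m n with h | h
      · exact ⟨_, Or.inl (by simpa using ha.mul_inv hb h)⟩
      · exact ⟨_, Or.inr (by simpa using hb.mul_inv ha h)⟩
    · rcases le_total m n with h | h
      · exact ⟨_, Or.inr (by simpa using hb.inv_mul ha h)⟩
      · exact ⟨_, Or.inl (by simpa using ha.inv_mul hb h)⟩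
    · exact ⟨_, Or.inr (by simpa using hb.mul ha)⟩
  inv_mem' {a} := by
    rintro ⟨n, ha⟩
    exact ⟨n, by simpa using ha.symm⟩

/-- The inertia group as a subgroup of the Weil group (which contains it). -/
def weilInertia : Subgroup (weilGroup p F) := (inertia p F).subgroupOf (weilGroup p F)

instance weilInertia_normal : (weilInertia p F).Normal :=
  inferInstanceAs ((inertia p F).subgroupOf (weilGroup p F)).Normal

/-- The topology of the Weil group: the coarsest one for which the inclusion into the absolute
Galois group and the projection to the discrete group `W_F / I_F` are continuous. So inertia is an
open subgroup and carries its profinite topology. -/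
abbrev weilTopology : TopologicalSpace (weilGroup p F) :=
  TopologicalSpace.induced (fun w => (w : AbsGal F)) inferInstance ⊓
    TopologicalSpace.induced (fun w => (w : weilGroup p F ⧸ weilInertia p F)) ⊥

variable {p F} in
/-- `Φ` is a geometric Frobenius element: its inverse acts as `x ↦ x ^ q` on the residue field. -/
def IsGeomFrob (Φ : weilGroup p F) : Prop := ActsAsFrobPow p ((Φ : AbsGal F)⁻¹) 1

variable {F} in
/-- The Weil group of an extension `E` of `F` inside `AlgebraicClosure F`, as the subgroup of the
Weil group of `F` fixing `E`. -/
def weilSubgroup (E : IntermediateField F (AlgebraicClosure F)) : Subgroup (weilGroup p F) :=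
  E.fixingSubgroup.subgroupOf (weilGroup p F)

variable {F} in
/-- The topology of the Weil group of `E`. -/
abbrev weilSubgroupTopology (E : IntermediateField F (AlgebraicClosure F)) :
    TopologicalSpace (weilSubgroup p E) :=
  (weilTopology p F).induced Subtype.val

variable {F} in
/-- `E / F` is a finite unramified extension: it has ramification index one, that is, `E` and `F`
have the same value group (the extension of finite residue fields is always separable). -/
def IsUnramified (E : IntermediateField F (AlgebraicClosure F)) : Prop :=
  FiniteDimensional F E ∧ ∀ x ∈ E, ∃ y : F,
    absVal p (AlgebraicClosure F) x =
      absVal p (AlgebraicClosure F) (algebraMap F (AlgebraicClosure F) y)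

end WeilGroup

section Representations

variable {G : Type*} [Group G] {V : Type*} [AddCommGroup V] [Module ℂ V]

/-- A representation is smooth if all stabilizers of vectors are open. -/
def IsSmooth (t : TopologicalSpace G) (ρ : Representation ℂ G V) : Prop :=
  ∀ v : V, @IsOpen G t {g : G | ρ g v = v}

/-- A representation is self-dual if it is isomorphic to its contragredient. -/
def IsSelfDual (ρ : Representation ℂ G V) : Prop := Nonempty (ρ.Equiv ρ.dual)

/-- There is a nondegenerate invariant symmetric bilinear form. -/
def IsOrthogonal (ρ : Representation ℂ G V) : Prop :=
  ∃ B : LinearMap.BilinForm ℂ V, B.Nondegenerate ∧ (∀ x y, B x y = B y x) ∧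
    ∀ g x y, B (ρ g x) (ρ g y) = B x y

/-- There is a nondegenerate invariant alternating bilinear form. -/
def IsSymplectic (ρ : Representation ℂ G V) : Prop :=
  ∃ B : LinearMap.BilinForm ℂ V, B.Nondegenerate ∧ (∀ x, B x x = 0) ∧
    ∀ g x y, B (ρ g x) (ρ g y) = B x y

/-- The exterior square of a representation. -/
def extSq (ρ : Representation ℂ G V) : Representation ℂ G (⋀[ℂ]^2 V) where
  toFun g := exteriorPower.map 2 (ρ g)
  map_one' := by
    rw [map_one, Module.End.one_eq_id, exteriorPower.map_id, Module.End.one_eq_id]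
  map_mul' g h := by
    rw [map_mul, Module.End.mul_eq_comp, Module.End.mul_eq_comp, exteriorPower.map_comp]

/-- The map induced by a linear map on symmetric squares. -/
def symSqMap {W : Type*} [AddCommGroup W] [Module ℂ W] (f : V →ₗ[ℂ] W) :
    Sym[ℂ]^2 V →ₗ[ℂ] Sym[ℂ]^2 W where
  __ := AddCon.lift (addConGen (SymmetricPower.Rel ℂ (Fin 2) V))
    ((SymmetricPower.mk ℂ (Fin 2) W) ∘ₗ PiTensorProduct.map fun _ => f).toAddMonoidHom
    (AddCon.addConGen_le.2 fun x y h => by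
      obtain ⟨e, g⟩ := h
      simpa [AddCon.ker_rel, SymmetricPower.tprod] using
        (SymmetricPower.tprod_equiv (R := ℂ) e fun i => f (g i)).symm)
  map_smul' r x := AddCon.induction_on x fun x =>
    map_smul ((SymmetricPower.mk ℂ (Fin 2) W) ∘ₗ PiTensorProduct.map fun _ => f) r x

lemma symSqMap_tprod {W : Type*} [AddCommGroup W] [Module ℂ W] (f : V →ₗ[ℂ] W) (x : Fin 2 → V) :
    symSqMap f (SymmetricPower.tprod ℂ x) = SymmetricPower.tprod ℂ fun i => f (x i) :=
  congrArg (SymmetricPower.mk ℂ (Fin 2) W) (PiTensorProduct.map_tprod (fun _ => f) x)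

lemma symSq_hom_ext {U : Type*} [AddCommGroup U] [Module ℂ U] {f g : Sym[ℂ]^2 V →ₗ[ℂ] U}
    (h : ∀ x, f (SymmetricPower.tprod ℂ x) = g (SymmetricPower.tprod ℂ x)) : f = g :=
  LinearMap.ext_on_range (SymmetricPower.span_tprod_eq_top ℂ (Fin 2) V) h

/-- The symmetric square of a representation. -/
def symSq (ρ : Representation ℂ G V) : Representation ℂ G (Sym[ℂ]^2 V) where
  toFun g := symSqMap (ρ g)
  map_one' := symSq_hom_ext fun x => by rw [symSqMap_tprod]; simp
  map_mul' g h := symSq_hom_ext fun x => by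
    rw [symSqMap_tprod, Module.End.mul_apply, symSqMap_tprod, symSqMap_tprod]; simp

end Representations

section LFactor

variable (p : ℕ) [Fact p.Prime] {F : Type*} [Field F] [Algebra ℚ_[p] F] [FiniteDimensional ℚ_[p] F]
  {V : Type*} [AddCommGroup V] [Module ℂ V]

/-- The local `L`-factor `L(s, τ) = det(1 - q ^ (-s) Φ | τ ^ {I_F})⁻¹`, for a geometric Frobenius
element `Φ`. Poles of `L(s, τ)` are given the value `0`. -/
def lFactor (Φ : weilGroup p F) (τ : Representation ℂ (weilGroup p F) V) (s : ℂ) : ℂ :=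
  (LinearMap.det
    (1 - (residueCard p F : ℂ) ^ (-s) • τ.toInvariants (weilInertia p F) Φ))⁻¹

/-- `ρ` is isomorphic to `Ind_{W_E}^{W_F} σ` for some finite-dimensional smooth representation `σ`
of `W_E`. -/
def IsInducedFrom (ρ : Representation ℂ (weilGroup p F) V)
    (E : IntermediateField F (AlgebraicClosure F)) : Prop :=
  ∃ (n : ℕ) (σ : Representation ℂ (weilSubgroup p E) (Fin n → ℂ)),
    IsSmooth (weilSubgroupTopology p E) σ ∧
      Nonempty (ρ.Equiv (Representation.ind (weilSubgroup p E).subtype σ))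

/-- `E / F` is a maximal unramified extension from which `ρ` is induced. -/
def IsMaximalInducing (ρ : Representation ℂ (weilGroup p F) V)
    (E : IntermediateField F (AlgebraicClosure F)) : Prop :=
  IsUnramified p E ∧ IsInducedFrom p ρ E ∧
    ∀ E', E ≤ E' → IsUnramified p E' → IsInducedFrom p ρ E' → E' = E

end LFactor

end WeilRep

end

/-! Let `B` be the invariant form on `ρ`. Through `B`, the space `V ⊗ V` becomes `End V` with Weil
group elements acting by conjugation. The exterior square (for symmetric `B`) or the symmetric
square (for alternating `B`) becomes the space of skew-adjoint endomorphisms. So both halves of the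
theorem ask for the same thing: the skew-adjoint endomorphisms commuting with inertia, and the
Frobenius action on them.

The inertial commutant is cyclic. Since `ρ` is induced from the unramified extension of degree `d`,
it carries an endomorphism `b` with `b ^ d = 1` which intertwines `ρ` with its twist by an
unramified character of order `d`; the representation `σ` lives on the subspace fixed by `b`.
Conjugation by Frobenius preserves the commutant, and an eigenvector there intertwines `ρ` with an
unramified twist. A twist of larger order would induce `ρ` from a larger unramified extension, so by
maximality only `d`-th roots of unity occur as eigenvalues. Schur's lemma and a trace argument
excluding Jordan blocks then show that the powers of `b` span the commutant
(`kerCommutant_le_span`).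

The adjoint of `b` intertwines the same twist, so it is `b` or `-b` (`IsTwist.exists_sign`). If it
is `b`, the whole commutant is self-adjoint, no nonzero skew element exists, and the determinant is
`1`; moreover `B` restricts to a nondegenerate form on `σ`. If it is `-b`, then `d = 2e`, the skew
elements are spanned by the odd powers of `b`, and Frobenius has the odd powers of a primitive
`d`-th root of unity as eigenvalues, giving `1 + X ^ e`; here `σ` cannot be self-dual
(`InducingData.not_isSelfDual`).

The arithmetic input is that finite unramified extensions are exactly those generated by the roots
of unity of order `q ^ n - 1` (`IsUnramified.exists_eq_unramifiedExt`), and that the Weil group has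
a degree map with kernel inertia for which the subgroup fixing the extension of degree `n` is given
by divisibility by `n` (`mem_weilSubgroup_unramifiedExt_iff`). -/

noncomputable section

namespace WeilRep

/-! ### Schur's lemma for intertwiners up to a character. -/

section Twist

variable {G : Type*} [Group G] {V : Type*} [AddCommGroup V] [Module ℂ V]

/-- `a` intertwines `ρ` with its twist by the character `χ`. -/
def IsTwist (ρ : Representation ℂ G V) (χ : G →* ℂˣ) (a : Module.End ℂ V) : Prop :=
  ∀ g, ρ g * a = (χ g : ℂ) • (a * ρ g)

variable {ρ : Representation ℂ G V} {χ ψ : G →* ℂˣ} {a b : Module.End ℂ V}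

lemma IsTwist.one : IsTwist ρ 1 1 := fun g => by simp

lemma IsTwist.mul (ha : IsTwist ρ χ a) (hb : IsTwist ρ ψ b) : IsTwist ρ (χ * ψ) (a * b) :=
    fun g => by
  rw [← mul_assoc, ha g, smul_mul_assoc, mul_assoc, hb g, mul_smul_comm, smul_smul, mul_assoc]
  simp

lemma IsTwist.pow (ha : IsTwist ρ χ a) (n : ℕ) : IsTwist ρ (χ ^ n) (a ^ n) := by
  induction n with
  | zero =>
    have h : χ ^ 0 = 1 := by ext; simp
    rw [h, pow_zero]
    exact IsTwist.one
  | succ n ih =>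
    have h : χ ^ (n + 1) = χ ^ n * χ := by ext; simp [pow_succ]
    rw [h, pow_succ]
    exact ih.mul ha

lemma IsTwist.smul (ha : IsTwist ρ χ a) (c : ℂ) : IsTwist ρ χ (c • a) := fun g => by
  rw [mul_smul_comm, ha g, smul_mul_assoc, smul_comm]

lemma IsTwist.sub (ha : IsTwist ρ χ a) (hb : IsTwist ρ χ b) : IsTwist ρ χ (a - b) := fun g => by
  rw [mul_sub, sub_mul, smul_sub, ha g, hb g]

lemma eq_bot_or_eq_top_of_invariant (hirr : ρ.IsIrreducible) (S : Submodule ℂ V)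
    (hS : ∀ g, ∀ v ∈ S, ρ g v ∈ S) : S = ⊥ ∨ S = ⊤ := by
  have := hirr.eq_bot_or_eq_top (⟨S, fun g v hv => hS g v hv⟩ : Subrepresentation ρ)
  rcases this with h | h
  · exact Or.inl (congrArg Subrepresentation.toSubmodule h)
  · exact Or.inr (congrArg Subrepresentation.toSubmodule h)

lemma IsIrreducible.nontrivial (hirr : ρ.IsIrreducible) : Nontrivial V := by
  by_contra h
  rw [not_nontrivial_iff_subsingleton] at h
  exact (bot_ne_top (α := Subrepresentation ρ))
    (Subrepresentation.toSubmodule_injective (Subsingleton.elim _ _))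

lemma IsTwist.injective (hirr : ρ.IsIrreducible) (ha : IsTwist ρ χ a) (h0 : a ≠ 0) :
    Function.Injective a := by
  rw [← LinearMap.ker_eq_bot]
  refine (eq_bot_or_eq_top_of_invariant hirr _ fun g v hv => ?_).resolve_right fun h =>
    h0 (LinearMap.ker_eq_top.1 h)
  have h1 := LinearMap.congr_fun (ha g) v
  rw [LinearMap.mem_ker] at hv ⊢
  simp only [Module.End.mul_apply, hv, map_zero, LinearMap.smul_apply] at h1
  exact (smul_eq_zero.1 h1.symm).resolve_left (Units.ne_zero _)

variable [FiniteDimensional ℂ V]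

lemma IsTwist.isUnit (hirr : ρ.IsIrreducible) (ha : IsTwist ρ χ a) (h0 : a ≠ 0) : IsUnit a :=
  (LinearMap.isUnit_iff_ker_eq_bot a).2 (LinearMap.ker_eq_bot.2 (ha.injective hirr h0))

/-- For an eigenvalue `c` of `a⁻¹ b`, the difference `b - c • a` is a twist for the same character
with nonzero kernel, so it vanishes. -/
lemma IsTwist.exists_eq_smul (hirr : ρ.IsIrreducible) (ha : IsTwist ρ χ a) (h0 : a ≠ 0)
    (hb : IsTwist ρ χ b) : ∃ c : ℂ, b = c • a := by
  obtain ⟨u, rfl⟩ := ha.isUnit hirr h0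
  have := IsIrreducible.nontrivial hirr
  obtain ⟨c, hc⟩ := Module.End.exists_eigenvalue ((↑u⁻¹ : Module.End ℂ V) * b)
  obtain ⟨v, hv⟩ := hc.exists_hasEigenvector
  refine ⟨c, sub_eq_zero.1 (by_contra fun h => hv.2 ?_)⟩
  refine (hb.sub (ha.smul c)).injective hirr h ?_
  have h2 := congrArg (u : Module.End ℂ V) hv.apply_eq_smul
  rw [← Module.End.mul_apply, ← mul_assoc, Units.mul_inv, one_mul, map_smul] at h2
  simp [h2]

end Twist

/-! ### The commutant of the kernel of a degree map, and its cyclic basis. -/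

section Cyclic

variable {G : Type*} [Group G] {V : Type*} [AddCommGroup V] [Module ℂ V]

/-- The character `g ↦ z ^ ν(g)`. -/
def powChar (ν : G →* Multiplicative ℤ) (z : ℂˣ) : G →* ℂˣ := (zpowersHom ℂˣ z).comp ν

lemma powChar_apply (ν : G →* Multiplicative ℤ) (z : ℂˣ) (g : G) :
    powChar ν z g = z ^ (ν g).toAdd := rfl

lemma powChar_mul (ν : G →* Multiplicative ℤ) (z w : ℂˣ) :
    powChar ν (z * w) = powChar ν z * powChar ν w := by
  ext g; simp [powChar_apply, mul_zpow]

lemma powChar_pow (ν : G →* Multiplicative ℤ) (z : ℂˣ) (n : ℕ) :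
    powChar ν (z ^ n) = powChar ν z ^ n := by
  ext g; simp only [powChar_apply, MonoidHom.pow_apply, ← zpow_natCast, ← zpow_mul, mul_comm]

lemma powChar_one (ν : G →* Multiplicative ℤ) : powChar ν 1 = 1 := by
  ext g; simp [powChar_apply]

variable {ρ : Representation ℂ G V} {ν : G →* Multiplicative ℤ} {Φ : G}
  {a b : Module.End ℂ V} {z w : ℂˣ} {d : ℕ}

/-- The elements satisfying the twist relation form a subgroup, and `Φ` together with the kernel of
`ν` generates `G`. -/
lemma isTwist_powChar (hΦ : ν Φ = Multiplicative.ofAdd 1) (ha : ∀ g, ν g = 1 → ρ g * a = a * ρ g)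
    (hz : ρ Φ * a = (z : ℂ) • (a * ρ Φ)) : IsTwist ρ (powChar ν z) a := by
  let S : Subgroup G :=
    { carrier := {g | ρ g * a = (powChar ν z g : ℂ) • (a * ρ g)}
      one_mem' := by simp
      mul_mem' := fun {g h} hg hh => by
        simp only [Set.mem_ofPred_eq] at *
        rw [map_mul, mul_assoc, hh, mul_smul_comm, ← mul_assoc, hg, smul_mul_assoc, smul_smul,
          map_mul, mul_assoc, mul_comm, Units.val_mul]
      inv_mem' := fun {g} hg => by
        simp only [Set.mem_ofPred_eq] at *
        have h1 : ρ g * ρ g⁻¹ = 1 := by rw [← map_mul]; simp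
        have h2 : ρ g⁻¹ * ρ g = 1 := by rw [← map_mul]; simp
        have h3 : ρ g⁻¹ * (ρ g * a) * ρ g⁻¹ = ρ g⁻¹ * ((powChar ν z g : ℂ) • (a * ρ g)) * ρ g⁻¹ :=
          by
          rw [hg]
        rw [← mul_assoc, h2, one_mul, mul_smul_comm, smul_mul_assoc, mul_assoc, mul_assoc, h1,
          mul_one] at h3
        rw [h3, smul_smul, ← Units.val_mul, ← map_mul]
        simp }
  have hΦS : Φ ∈ S := by
    change ρ Φ * a = (powChar ν z Φ : ℂ) • (a * ρ Φ)
    rw [hz, powChar_apply, hΦ]; simp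
  intro g
  have hk : (Φ ^ (ν g).toAdd)⁻¹ * g ∈ S := by
    have h1 : ν ((Φ ^ (ν g).toAdd)⁻¹ * g) = 1 := by
      rw [map_mul, map_inv, map_zpow, hΦ, ← ofAdd_zsmul]; simp
    change _ = _
    rw [powChar_apply, h1, ha _ h1]; simp
  have := S.mul_mem (S.zpow_mem hΦS (ν g).toAdd) hk
  rwa [mul_inv_cancel_left] at this

/-- The endomorphisms of `ρ` commuting with the kernel of `ν`. -/
def kerCommutant (ρ : Representation ℂ G V) (ν : G →* Multiplicative ℤ) :
    Submodule ℂ (Module.End ℂ V) where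
  carrier := {a | ∀ g, ν g = 1 → ρ g * a = a * ρ g}
  add_mem' ha hb g hg := by rw [mul_add, add_mul, ha g hg, hb g hg]
  zero_mem' g hg := by simp
  smul_mem' c a ha g hg := by rw [mul_smul_comm, smul_mul_assoc, ha g hg]

lemma IsTwist.mem_kerCommutant {ρ : Representation ℂ G V} (ha : IsTwist ρ (powChar ν z) a) :
    a ∈ kerCommutant ρ ν := fun g hg => by
  rw [ha g, powChar_apply, hg]; simp

variable [FiniteDimensional ℂ V]

/-- Compare determinants in the twist relation at `Φ`. This is what makes `z` a root of unity. -/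
lemma IsTwist.pow_finrank_eq_one (hirr : ρ.IsIrreducible) (hΦ : ν Φ = Multiplicative.ofAdd 1)
    (ha : IsTwist ρ (powChar ν z) a) (h0 : a ≠ 0) : z ^ Module.finrank ℂ V = 1 := by
  have h1 := congrArg LinearMap.det (ha Φ)
  rw [LinearMap.det_smul, map_mul, map_mul, powChar_apply, hΦ] at h1
  have h2 : LinearMap.det a ≠ 0 := ((ha.isUnit hirr h0).map LinearMap.det).ne_zero
  have h3 : LinearMap.det (ρ Φ) ≠ 0 := by
    have : IsUnit (ρ Φ) := (Group.isUnit Φ).map ρ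
    exact (this.map LinearMap.det).ne_zero
  ext
  simp only [toAdd_ofAdd, zpow_one] at h1
  have h4 : LinearMap.det (ρ Φ) * LinearMap.det a ≠ 0 := mul_ne_zero h3 h2
  rw [Units.val_pow_eq_pow_val, Units.val_one]
  apply mul_right_cancel₀ h4
  rw [one_mul]; nth_rewrite 2 [h1]; ring

/-- The defining property of the maximal order `d` of an unramified twist fixing `ρ`. -/
def IsMaximalTwist (ρ : Representation ℂ G V) (ν : G →* Multiplicative ℤ) (d : ℕ) : Prop :=
  ∀ t : ℕ, 0 < t → d ∣ t → ∀ z : ℂˣ, orderOf z = t → ∀ a : Module.End ℂ V,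
    IsTwist ρ (powChar ν z) a → a ^ t = 1 → t = d

/-- Suitable powers of `z` and `w` multiply to an element whose order is the lcm of their orders,
and this element again twists `ρ` to itself. Maximality makes that lcm equal to `d`. -/
lemma IsTwist.pow_eq_one (hirr : ρ.IsIrreducible) (hΦ : ν Φ = Multiplicative.ofAdd 1)
    (hmax : IsMaximalTwist ρ ν d) (hd : 0 < d) (hw : orderOf w = d)
    (hb : IsTwist ρ (powChar ν w) b) (hb1 : b ≠ 0)
    (ha : IsTwist ρ (powChar ν z) a) (h0 : a ≠ 0) : z ^ d = 1 := by
  have := IsIrreducible.nontrivial hirr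
  have hz : orderOf z ≠ 0 := by
    have : IsOfFinOrder z := isOfFinOrder_iff_pow_eq_one.2
      ⟨_, Module.finrank_pos, ha.pow_finrank_eq_one hirr hΦ h0⟩
    exact this.orderOf_pos.ne'
  have hlcm := (Commute.all z w).orderOf_mul_pow_eq_lcm hz (by omega)
  set i := orderOf z / _
  set j := orderOf w / Nat.factorizationLCMRight _ _
  set t := Nat.lcm (orderOf z) (orderOf w) with ht
  have ht0 : 0 < t := Nat.lcm_pos (by omega) (by omega)
  have hc := (ha.pow i).mul (hb.pow j)
  rw [← powChar_pow, ← powChar_pow, ← powChar_mul] at hc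
  have hu : IsUnit (a ^ i * b ^ j) :=
    ((ha.isUnit hirr h0).pow i).mul ((hb.isUnit hirr hb1).pow j)
  set c := a ^ i * b ^ j
  have hct := hc.pow t
  rw [← powChar_pow, ← hlcm, pow_orderOf_eq_one, powChar_one, hlcm] at hct
  obtain ⟨s, hs⟩ := IsTwist.one.exists_eq_smul hirr one_ne_zero hct
  have hs0 : s ≠ 0 := by
    rintro rfl
    rw [zero_smul] at hs
    exact (hu.pow t).ne_zero hs
  -- By Schur `c ^ t` is a scalar `s`; a `t`-th root of `s⁻¹` normalises `c` so that its `t`-th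
  -- power is exactly `1`.
  obtain ⟨r, hr⟩ := IsAlgClosed.exists_pow_nat_eq s⁻¹ ht0
  have key := hmax t ht0 (hw ▸ Nat.dvd_lcm_right _ _) _ hlcm (r • c) (hc.smul r)
    (by rw [_root_.smul_pow, hr, hs, smul_smul, inv_mul_cancel₀ hs0, one_smul])
  exact orderOf_dvd_iff_pow_eq_one.1 (key ▸ Nat.dvd_lcm_left _ _)

/-- The commutant is the sum of its generalised eigenspaces under conjugation by `Φ`. Eigenvectors
are twists, so each eigenvalue is some `w ^ k` and its eigenspace is the line through `b ^ k`. The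
trace shows that no generalised eigenspace is larger. -/
theorem kerCommutant_le_span (hirr : ρ.IsIrreducible) (hΦ : ν Φ = Multiplicative.ofAdd 1)
    (hmax : IsMaximalTwist ρ ν d) (hd : 0 < d) (hw : orderOf w = d)
    (hb : IsTwist ρ (powChar ν w) b) (hbd : b ^ d = 1) :
    kerCommutant ρ ν ≤ Submodule.span ℂ (Set.range fun k : Fin d => b ^ (k : ℕ)) := by
  have := IsIrreducible.nontrivial hirr
  have hb0 : b ≠ 0 := by
    rintro rfl
    rw [zero_pow hd.ne'] at hbd
    exact zero_ne_one hbd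
  have hinv : ρ Φ * ρ Φ⁻¹ = 1 := by rw [← map_mul]; simp
  have hinv' : ρ Φ⁻¹ * ρ Φ = 1 := by rw [← map_mul]; simp
  let c : Module.End ℂ (Module.End ℂ V) :=
    (LinearMap.mulLeft ℂ (ρ Φ)) * (LinearMap.mulRight ℂ (ρ Φ⁻¹))
  have hc (x) : c x = ρ Φ * x * ρ Φ⁻¹ := by simp [c, mul_assoc]
  have hcA : ∀ x ∈ kerCommutant ρ ν, c x ∈ kerCommutant ρ ν := fun x hx g hg => by
    have h1 := hx (Φ⁻¹ * g * Φ) (by simp [hg])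
    rw [hc]
    have h2 : ρ g = ρ Φ * ρ (Φ⁻¹ * g * Φ) * ρ Φ⁻¹ := by
      rw [← map_mul, ← map_mul]; congr 1; group
    calc ρ g * (ρ Φ * x * ρ Φ⁻¹) = ρ Φ * ρ (Φ⁻¹ * g * Φ) * (ρ Φ⁻¹ * ρ Φ) * x * ρ Φ⁻¹ := by
          rw [h2]; simp only [mul_assoc]
      _ = ρ Φ * x * (ρ Φ⁻¹ * ρ Φ) * ρ (Φ⁻¹ * g * Φ) * ρ Φ⁻¹ := by
          rw [hinv', mul_one, mul_one, mul_assoc _ _ x, h1]; simp only [mul_assoc]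
      _ = _ := by rw [h2]; simp only [mul_assoc]
  have htw (x) (hx : x ∈ kerCommutant ρ ν) (μ : ℂˣ) (h : c x = (μ : ℂ) • x) :
      IsTwist ρ (powChar ν μ) x := by
    refine isTwist_powChar hΦ hx ?_
    rw [hc] at h
    rw [← smul_mul_assoc, ← h, mul_assoc _ _ (ρ Φ), hinv', mul_one]
  have hc0 (x) (h : c x = 0) : x = 0 := by
    rw [hc] at h
    calc x = ρ Φ⁻¹ * (ρ Φ * x * ρ Φ⁻¹) * ρ Φ := by
          rw [mul_assoc, mul_assoc, mul_assoc, hinv', mul_one, ← mul_assoc, hinv', one_mul]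
      _ = 0 := by rw [h]; simp
  -- eigenvectors for the eigenvalue `μ` exist only if `μ` is a power of `w`
  have hpow (x) (hx : x ∈ kerCommutant ρ ν) (hx0 : x ≠ 0) (μ : ℂ) (h : c x = μ • x) :
      ∃ k < d, ((w : ℂ) ^ k) = μ := by
    have hμ : μ ≠ 0 := by
      rintro rfl
      exact hx0 (hc0 x (by simpa using h))
    have h1 := IsTwist.pow_eq_one hirr hΦ hmax hd hw hb hb0
      (htw x hx (Units.mk0 μ hμ) (by simpa using h)) hx0
    have hp : IsPrimitiveRoot (w : ℂ) d :=
      (hw ▸ IsPrimitiveRoot.orderOf w).map_of_injective (f := Units.coeHom ℂ) Units.val_injective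
    have : NeZero d := ⟨hd.ne'⟩
    exact hp.eq_pow_of_pow_eq_one (by simpa using congrArg Units.val h1)
  have hgen (k : ℕ) (hk : k < d) (n : ℕ) : ∀ x ∈ kerCommutant ρ ν,
      ((c - algebraMap ℂ _ ((w : ℂ) ^ k)) ^ n) x = 0 → ∃ s : ℂ, x = s • b ^ k := by
    have hbk : IsTwist ρ (powChar ν (w ^ k)) (b ^ k) := by rw [powChar_pow]; exact hb.pow k
    have hbk' : c (b ^ (d - k)) = ((w : ℂ) ^ (d - k)) • b ^ (d - k) := by
      have h1 := hb.pow (d - k) Φ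
      rw [← powChar_pow, powChar_apply, hΦ] at h1
      rw [hc, h1, smul_mul_assoc, mul_assoc, hinv]
      simp
    induction n with
    | zero => intro x _ h; exact ⟨0, by simpa using h⟩
    | succ n ih =>
      intro x hx h
      have hy : c x - ((w : ℂ) ^ k) • x ∈ kerCommutant ρ ν :=
        Submodule.sub_mem _ (hcA x hx) (Submodule.smul_mem _ _ hx)
      obtain ⟨s, hs⟩ := ih _ hy (by
        rw [pow_succ, Module.End.mul_apply] at h
        simpa [Algebra.algebraMap_eq_smul_one] using h)
      have hmulc : c (b ^ (d - k) * x) = c (b ^ (d - k)) * c x := by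
        rw [hc, hc, hc]
        calc _ = ρ Φ * b ^ (d - k) * (1 * (x * ρ Φ⁻¹)) := by simp only [mul_assoc, one_mul]
          _ = _ := by rw [← hinv']; simp only [mul_assoc]
      -- If `c x = w ^ k • x + s • b ^ k`, then `c` maps `b ^ (d - k) * x` to itself plus a nonzero
      -- multiple of `s • 1`. Conjugation preserves the trace, so `s * dim V = 0`.
      have htr : LinearMap.trace ℂ V (c (b ^ (d - k) * x)) =
          LinearMap.trace ℂ V (b ^ (d - k) * x) := by
        rw [hc, LinearMap.trace_mul_comm, ← mul_assoc, hinv', one_mul]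
      have hwd : (w : ℂ) ^ (d - k) * (w : ℂ) ^ k = 1 := by
        rw [← pow_add, Nat.sub_add_cancel hk.le, ← Units.val_pow_eq_pow_val, ← hw,
          pow_orderOf_eq_one, Units.val_one]
      have hbb : b ^ (d - k) * b ^ k = 1 := by rw [← pow_add, Nat.sub_add_cancel hk.le, hbd]
      rw [hmulc, hbk', sub_eq_iff_eq_add.1 hs, mul_add, mul_smul_comm, mul_smul_comm,
        smul_mul_assoc, smul_mul_assoc, hbb, smul_smul _ _ (b ^ (d - k) * x), mul_comm, hwd,
          one_smul,
        map_add, add_eq_right, smul_smul, map_smul, LinearMap.trace_one, smul_eq_mul] at htr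
      have hn : (Module.finrank ℂ V : ℂ) ≠ 0 := Nat.cast_ne_zero.2 Module.finrank_pos.ne'
      have hs0 : s = 0 := by
        rcases mul_eq_zero.1 htr with h | h
        · rcases mul_eq_zero.1 h with h | h
          · exact h
          · exact absurd h (pow_ne_zero _ w.ne_zero)
        · exact absurd h hn
      rw [hs0, zero_smul, sub_eq_zero] at hs
      have hbk0 : b ^ k ≠ 0 := fun h => by rw [h, mul_zero] at hbb; exact zero_ne_one hbb
      exact hbk.exists_eq_smul hirr hbk0 (htw x hx (w ^ k) (by simpa using hs))
  rw [Submodule.eq_iSup_inf_genEigenspace (f := c) ⊤ hcA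
    (Module.End.iSup_maxGenEigenspace_eq_top c)]
  refine iSup_le fun μ x ⟨hx, hxμ⟩ => ?_
  by_cases hx0 : x = 0
  · rw [hx0]; exact Submodule.zero_mem _
  rw [SetLike.mem_coe, ← Module.End.maxGenEigenspace, Module.End.mem_maxGenEigenspace] at hxμ
  have hex : ∃ n, ((c - μ • (1 : Module.End ℂ (Module.End ℂ V))) ^ n) x = 0 := hxμ
  -- The last nonzero iterate of `c - μ` on a generalised eigenvector is a genuine eigenvector, to
  -- which `hpow` applies.
  obtain ⟨k, hk, hkμ⟩ : ∃ k < d, ((w : ℂ) ^ k) = μ := by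
    classical
    have hn := Nat.find_spec hex
    have hpos : Nat.find hex ≠ 0 := fun h => by rw [h] at hn; exact hx0 (by simpa using hn)
    obtain ⟨m, hm⟩ := Nat.exists_eq_succ_of_ne_zero hpos
    have hmin : ((c - μ • (1 : Module.End ℂ (Module.End ℂ V))) ^ m) x ≠ 0 :=
      Nat.find_min hex (by omega)
    have hmem (m : ℕ) : ((c - μ • (1 : Module.End ℂ (Module.End ℂ V))) ^ m) x ∈ kerCommutant ρ ν :=
      by
      induction m with
      | zero => simpa using hx
      | succ m ih =>
        rw [pow_succ', Module.End.mul_apply]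
        simpa using Submodule.sub_mem _ (hcA _ ih) (Submodule.smul_mem _ μ ih)
    refine hpow _ (hmem m) hmin μ ?_
    rw [hm, pow_succ', Module.End.mul_apply] at hn
    simpa [sub_eq_zero] using hn
  obtain ⟨n, hn⟩ := hex
  obtain ⟨s, hs⟩ := hgen k hk n x hx (by rw [hkμ, Algebra.algebraMap_eq_smul_one]; exact hn)
  rw [hs]
  exact Submodule.smul_mem _ _ (Submodule.subset_span ⟨⟨k, hk⟩, rfl⟩)

/-- Every eigenvalue of `a` is a power `z ^ j`, and applying `ρ (Φ ^ j)` to an eigenvector divides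
the eigenvalue by `z ^ j`. -/
lemma IsTwist.exists_fixed [Nontrivial V] (hΦ : ν Φ = Multiplicative.ofAdd 1)
    (ha : IsTwist ρ (powChar ν z) a) (hd : 0 < d) (hz : orderOf z = d) (had : a ^ d = 1) :
    ∃ v : V, v ≠ 0 ∧ a v = v := by
  obtain ⟨μ, hμ⟩ := Module.End.exists_eigenvalue a
  obtain ⟨v, hv⟩ := hμ.exists_hasEigenvector
  have hμd : μ ^ d = 1 := by
    have h1 := hv.pow_apply d
    rw [had] at h1
    have : (μ ^ d - 1) • v = 0 := by rw [sub_smul, ← h1]; simp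
    exact sub_eq_zero.1 ((smul_eq_zero.1 this).resolve_right hv.2)
  have hp : IsPrimitiveRoot (z : ℂ) d :=
    (hz ▸ IsPrimitiveRoot.orderOf z).map_of_injective (f := Units.coeHom ℂ) Units.val_injective
  have : NeZero d := ⟨hd.ne'⟩
  obtain ⟨j, -, rfl⟩ := hp.eq_pow_of_pow_eq_one hμd
  have hinv : ρ (Φ ^ j)⁻¹ (ρ (Φ ^ j) v) = v := by
    rw [← Module.End.mul_apply, ← map_mul]; simp
  refine ⟨ρ (Φ ^ j) v, fun h => hv.2 (by rw [← hinv, h, map_zero]), ?_⟩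
  have h1 := LinearMap.congr_fun (ha (Φ ^ j)) v
  rw [Module.End.mul_apply, LinearMap.smul_apply, Module.End.mul_apply, hv.apply_eq_smul, map_smul,
    powChar_apply, map_pow ν, hΦ, ← ofAdd_nsmul] at h1
  simp only [nsmul_eq_mul, mul_one, toAdd_ofAdd, zpow_natCast, Units.val_pow_eq_pow_val] at h1
  exact (smul_right_injective _ (pow_ne_zero j z.ne_zero) h1).symm

end Cyclic

/-! ### Induction from the kernel of a finite-order character versus endomorphisms twisting the
representation. -/

section Ind

open Representation

variable {G : Type*} [Group G] {H : Subgroup G} {W : Type*} [AddCommGroup W] [Module ℂ W]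
  {σ : Representation ℂ H W} {U : Type*} [AddCommGroup U] [Module ℂ U]

lemma indV_mk_mul (h : H) (g : G) (a : W) :
    IndV.mk H.subtype σ (h * g) (σ h a) = IndV.mk H.subtype σ g a := by
  have := Coinvariants.sub_mem_ker
    (ρ := Representation.tprod ((leftRegular ℂ G).comp H.subtype) σ) h
    (MonoidAlgebra.single g 1 ⊗ₜ a)
  rw [← Coinvariants.mk_eq_iff] at this
  simpa using this

/-- The linear map out of an induced representation given by a compatible family of maps. -/
def indLift (f : G → W →ₗ[ℂ] U) (hf : ∀ (h : H) g a, f (h * g) (σ h a) = f g a) :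
    IndV H.subtype σ →ₗ[ℂ] U :=
  Coinvariants.lift _
    (TensorProduct.lift ((Finsupp.lift _ _ _ f) ∘ₗ
      (MonoidAlgebra.coeffLinearEquiv ℂ).toLinearMap))
    fun h => by
      ext g x
      simp only [LinearMap.coe_comp, Function.comp_apply, MonoidAlgebra.lsingle_apply]
      simp [hf]

@[simp]
lemma indLift_mk (f : G → W →ₗ[ℂ] U) (hf : ∀ (h : H) g a, f (h * g) (σ h a) = f g a) (g : G)
    (a : W) : indLift f hf (IndV.mk H.subtype σ g a) = f g a := by
  simp [indLift]

lemma indV_induction {C : IndV H.subtype σ → Prop} (h0 : C 0)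
    (hadd : ∀ x y, C x → C y → C (x + y)) (hmk : ∀ g a, C (IndV.mk H.subtype σ g a)) (x) : C x := by
  have hs : ∀ (c : ℂ) g a, C (c • IndV.mk H.subtype σ g a) := fun c g a => by
    rw [← map_smul]; exact hmk _ _
  obtain ⟨y, rfl⟩ := Coinvariants.mk_surjective _ x
  induction y using TensorProduct.induction_on with
  | zero => simpa using h0
  | add x y hx hy => rw [map_add]; exact hadd _ _ hx hy
  | tmul f a =>
    induction f using MonoidAlgebra.induction_linear with
    | zero => simpa using h0
    | add x y hx hy => rw [TensorProduct.add_tmul, map_add]; exact hadd _ _ hx hy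
    | single g c =>
      have := hs c g a
      rwa [← map_smul, LinearMap.comp_apply, TensorProduct.mk_apply, TensorProduct.tmul_smul,
        TensorProduct.smul_tmul', MonoidAlgebra.smul_single, smul_eq_mul, mul_one] at this

lemma geom_sum_eq_zero_of_pow_eq_one {x : ℂ} {t : ℕ} (h1 : x ≠ 1) (h : x ^ t = 1) :
    ∑ k ∈ Finset.range t, x ^ k = 0 := by
  have := geom_sum_mul x t
  rw [h, sub_self] at this
  exact (mul_eq_zero.1 this).resolve_right (sub_ne_zero.2 h1)

variable {ν : G →* Multiplicative ℤ} {d : ℕ} {w : ℂˣ}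

lemma powChar_eq_one_iff (hw : orderOf w = d) (hH : ∀ g, g ∈ H ↔ (d : ℤ) ∣ (ν g).toAdd) (g : G) :
    powChar ν w g = 1 ↔ g ∈ H := by
  rw [powChar_apply, hH, ← hw, orderOf_dvd_iff_zpow_eq_one]

lemma powChar_pow_eq_one (hw : orderOf w = d) (g : G) : powChar ν w g ^ d = 1 := by
  rw [powChar_apply, ← zpow_natCast, ← zpow_mul, mul_comm, zpow_mul, zpow_natCast, ← hw,
    pow_orderOf_eq_one, one_zpow]

lemma sum_powChar_pow (hw : orderOf w = d) (hH : ∀ g, g ∈ H ↔ (d : ℤ) ∣ (ν g).toAdd) (g : G)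
    (hg : g ∉ H) : ∑ k ∈ Finset.range d, (powChar ν w g : ℂ) ^ k = 0 := by
  apply geom_sum_eq_zero_of_pow_eq_one
  · rw [← Units.val_one, Ne, Units.val_inj, powChar_eq_one_iff hw hH]
    exact hg
  · rw [← Units.val_pow_eq_pow_val, powChar_pow_eq_one hw, Units.val_one]

variable {V : Type*} [AddCommGroup V] [Module ℂ V] {ρ : Representation ℂ G V}

/-- `W`, `V` are representations of `H`, `G` and `W` is the direct summand of `V` on which the
twist `b` of order `d` acts trivially. -/
structure InducingData (ρ : Representation ℂ G V) (σ : Representation ℂ H W)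
    (ν : G →* Multiplicative ℤ) (w : ℂˣ) (d : ℕ) where
  incl : W →ₗ[ℂ] V
  proj : V →ₗ[ℂ] W
  twist : Module.End ℂ V
  proj_incl : ∀ x, proj (incl x) = x
  incl_apply : ∀ (h : H) x, incl (σ h x) = ρ h (incl x)
  proj_apply : ∀ (h : H) v, proj (ρ h v) = σ h (proj v)
  isTwist : IsTwist ρ (powChar ν w) twist
  twist_pow : twist ^ d = 1
  twist_incl : ∀ x, twist (incl x) = incl x
  -- Averaging over the powers of `twist` projects onto the image of `incl`.
  sum_twist : ∀ v, ∑ k ∈ Finset.range d, (twist ^ k) v = (d : ℂ) • incl (proj v)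

/-- The data carried by an induced representation. -/
def inducingDataInd (hw : orderOf w = d) (hH : ∀ g, g ∈ H ↔ (d : ℤ) ∣ (ν g).toAdd) :
    InducingData (ind H.subtype σ) σ ν w d := by
  classical
  have h1 (g : G) (hg : g ∈ H) : powChar ν w g = 1 := (powChar_eq_one_iff hw hH g).2 hg
  -- The twist scales the summand attached to the coset of `g` by the character value at `g`; this
  -- is well defined because the character is trivial on `H`.
  let b : Module.End ℂ (IndV H.subtype σ) :=
    indLift (fun g => (powChar ν w g : ℂ) • IndV.mk H.subtype σ g) fun h g a => by
      rw [LinearMap.smul_apply, LinearMap.smul_apply, indV_mk_mul, map_mul, h1 h h.2, one_mul]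
  have hb (g a) : b (IndV.mk H.subtype σ g a) = (powChar ν w g : ℂ) • IndV.mk H.subtype σ g a := by
    rw [indLift_mk]; rfl
  have hbk (k : ℕ) (g a) : (b ^ k) (IndV.mk H.subtype σ g a) =
      (powChar ν w g : ℂ) ^ k • IndV.mk H.subtype σ g a := by
    induction k with
    | zero => simp
    | succ k ih => rw [pow_succ', Module.End.mul_apply, ih, map_smul, hb, smul_smul, pow_succ]
  -- Projection onto the summand of the trivial coset.
  let P : IndV H.subtype σ →ₗ[ℂ] W :=
    indLift (fun g => if hg : g ∈ H then σ (⟨g, hg⟩⁻¹) else 0) fun h g a => by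
      by_cases hg : g ∈ H
      · rw [dif_pos hg, dif_pos (H.mul_mem h.2 hg), ← Module.End.mul_apply, ← map_mul]
        congr 2
        ext
        simp
      · rw [dif_neg hg, dif_neg (by rwa [H.mul_mem_cancel_left h.2])]
        rfl
  have hP (g a) : P (IndV.mk H.subtype σ g a) = if hg : g ∈ H then σ (⟨g, hg⟩⁻¹) a else 0 := by
    simp only [P, indLift_mk]
    split_ifs <;> rfl
  exact
    { incl := IndV.mk H.subtype σ 1
      proj := P
      twist := b
      proj_incl := fun x => by
        rw [hP, dif_pos H.one_mem]
        have : (⟨1, H.one_mem⟩ : H)⁻¹ = 1 := by ext; simp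
        rw [this, map_one]; rfl
      incl_apply := fun h x => by
        rw [ind_mk, ← indV_mk_mul h (1 * (h : G)⁻¹) x]
        congr 1; group
      proj_apply := fun h v => by
        induction v using indV_induction with
        | h0 => simp
        | hadd x y hx hy => simp only [map_add, hx, hy]
        | hmk g a =>
          rw [ind_mk, hP, hP]
          by_cases hg : g ∈ H
          · rw [dif_pos hg, dif_pos (H.mul_mem hg (H.inv_mem h.2)), ← Module.End.mul_apply,
              ← map_mul]
            congr 2
            ext
            simp
          · rw [dif_neg hg, dif_neg (by rwa [H.mul_mem_cancel_right (H.inv_mem h.2)]), map_zero]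
      isTwist := fun g => by
        refine LinearMap.ext fun v => ?_
        induction v using indV_induction with
        | h0 => simp
        | hadd x y hx hy => simp only [map_add, hx, hy]
        | hmk g' a =>
          rw [LinearMap.smul_apply, Module.End.mul_apply, Module.End.mul_apply, hb, map_smul,
            ind_mk,
            hb, smul_smul, ← Units.val_mul, map_mul, map_inv, mul_comm, inv_mul_cancel_right]
      twist_pow := by
        refine LinearMap.ext fun v => ?_
        induction v using indV_induction with
        | h0 => simp
        | hadd x y hx hy => simp only [map_add, hx, hy]
        | hmk g' a =>
          rw [hbk, ← Units.val_pow_eq_pow_val, powChar_pow_eq_one hw]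
          simp
      twist_incl := fun x => by rw [hb]; simp
      sum_twist := fun v => by
        induction v using indV_induction with
        | h0 => simp
        | hadd x y hx hy => simp only [map_add, Finset.sum_add_distrib, hx, hy, smul_add]
        | hmk g a =>
          simp only [hbk, ← Finset.sum_smul]
          by_cases hg : g ∈ H
          · have h2 : IndV.mk H.subtype σ 1 (σ (⟨g, hg⟩⁻¹) a) = IndV.mk H.subtype σ g a := by
              rw [← indV_mk_mul ⟨g, hg⟩ 1, ← Module.End.mul_apply, ← map_mul, mul_inv_cancel,
                map_one, mul_one]
              rfl
            rw [hP, dif_pos hg, h2, h1 g hg]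
            simp
          · rw [hP, dif_neg hg, map_zero, smul_zero, sum_powChar_pow hw hH g hg, zero_smul] }

/-- The data carried by a representation isomorphic to an induced representation. -/
def inducingDataOfEquiv (hw : orderOf w = d) (hH : ∀ g, g ∈ H ↔ (d : ℤ) ∣ (ν g).toAdd)
    (e : ρ.Equiv (ind H.subtype σ)) : InducingData ρ σ ν w d := by
  let D : InducingData (ind H.subtype σ) σ ν w d := inducingDataInd hw hH
  have he (g v) : e (ρ g v) = ind H.subtype σ g (e v) := LinearMap.congr_fun (e.isIntertwining' g) v
  have hse (v) : e.symm (e v) = v := e.toLinearEquiv.symm_apply_apply v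
  have hes (v) : e (e.symm v) = v := e.toLinearEquiv.apply_symm_apply v
  have hes' (g v) : e.symm (ind H.subtype σ g v) = ρ g (e.symm v) := by
    rw [← hse (ρ g _), he, hes]
  have hbk (k : ℕ) (v) : ((e.toLinearEquiv.symm.toLinearMap ∘ₗ D.twist ∘ₗ
      e.toLinearEquiv.toLinearMap : Module.End ℂ V) ^ k) v = e.symm ((D.twist ^ k) (e v)) := by
    induction k with
    | zero => simp [hse]
    | succ k ih =>
      rw [pow_succ', Module.End.mul_apply, ih, pow_succ', Module.End.mul_apply]
      change e.symm (D.twist (e (e.symm _))) = _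
      rw [hes]
  exact
    { incl := e.toLinearEquiv.symm.toLinearMap ∘ₗ D.incl
      proj := D.proj ∘ₗ e.toLinearEquiv.toLinearMap
      twist := e.toLinearEquiv.symm.toLinearMap ∘ₗ D.twist ∘ₗ e.toLinearEquiv.toLinearMap
      proj_incl := fun x => by
        change D.proj (e (e.symm (D.incl x))) = x
        rw [hes, D.proj_incl]
      incl_apply := fun h x => by
        change e.symm (D.incl _) = ρ h (e.symm (D.incl x))
        rw [D.incl_apply, hes']
      proj_apply := fun h v => by
        change D.proj (e _) = σ h (D.proj (e v))
        rw [he, D.proj_apply]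
      isTwist := fun g => LinearMap.ext fun v => by
        change ρ g (e.symm (D.twist (e v))) = (powChar ν w g : ℂ) • e.symm (D.twist (e (ρ g v)))
        rw [he, ← hes', ← map_smul]
        exact congrArg _ (LinearMap.congr_fun (D.isTwist g) (e v))
      twist_pow := LinearMap.ext fun v => by rw [hbk, D.twist_pow]; exact hse v
      twist_incl := fun x => by
        change e.symm (D.twist (e (e.symm (D.incl x)))) = e.symm (D.incl x)
        rw [hes, D.twist_incl]
      sum_twist := fun v => by
        simp only [hbk, ← map_sum, D.sum_twist, map_smul]
        rfl }

/-- A representation with a twist of order `t` is induced from the subspace fixed by the twist. -/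
theorem equiv_ind_of_isTwist [FiniteDimensional ℂ V] (hirr : ρ.IsIrreducible) {Φ : G}
    (hΦ : ν Φ = Multiplicative.ofAdd 1) {z : ℂˣ} {t : ℕ} (ht : 0 < t) (hz : orderOf z = t)
    (hH : ∀ g, g ∈ H ↔ (t : ℤ) ∣ (ν g).toAdd) {a : Module.End ℂ V}
    (ha : IsTwist ρ (powChar ν z) a) (hat : a ^ t = 1) (ι : W →ₗ[ℂ] V) (hι : Function.Injective ι)
    (hισ : ∀ (h : H) x, ι (σ h x) = ρ h (ι x)) (hιa : ∀ v, v ∈ LinearMap.range ι ↔ a v = v) :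
    Nonempty (ρ.Equiv (ind H.subtype σ)) := by
  have hinv (g v) : ρ g⁻¹ (ρ g v) = v := by rw [← Module.End.mul_apply, ← map_mul]; simp
  have hinv' (g v) : ρ g (ρ g⁻¹ v) = v := by rw [← Module.End.mul_apply, ← map_mul]; simp
  have ht0 : (t : ℂ) ≠ 0 := Nat.cast_ne_zero.2 ht.ne'
  have ha' (g : G) (v : V) : a (ρ g v) = ((powChar ν z g)⁻¹ : ℂˣ) • ρ g (a v) := by
    have := LinearMap.congr_fun (ha g) v
    rw [Module.End.mul_apply, LinearMap.smul_apply, Module.End.mul_apply] at this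
    rw [this, Units.smul_def, smul_smul, ← Units.val_mul, inv_mul_cancel, Units.val_one, one_smul]
  -- The averaging projector onto the vectors fixed by `a`, that is, onto the range of `ι`.
  let p : V →ₗ[ℂ] V := (t : ℂ)⁻¹ • ∑ k ∈ Finset.range t, a ^ k
  have hp (v) : p v = (t : ℂ)⁻¹ • ∑ k ∈ Finset.range t, (a ^ k) v := by
    simp [p, LinearMap.sum_apply]
  have hpa (v) : a (p v) = p v := by
    rw [hp, map_smul, map_sum]
    congr 1
    have h1 := Finset.sum_range_succ (fun k => (a ^ k) v) t
    have h2 := Finset.sum_range_succ' (fun k => (a ^ k) v) t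
    rw [h1, hat] at h2
    simp only [pow_zero, add_left_inj] at h2
    rw [h2]
    exact Finset.sum_congr rfl fun k _ => by rw [pow_succ', Module.End.mul_apply]
  let P : V →ₗ[ℂ] W := (LinearEquiv.ofInjective ι hι).symm.toLinearMap ∘ₗ
    p.codRestrict _ fun v => (hιa _).2 (hpa v)
  have hP (v) : ι (P v) = p v := by
    have := congrArg Subtype.val ((LinearEquiv.ofInjective ι hι).apply_symm_apply
      ⟨p v, (hιa _).2 (hpa v)⟩)
    exact this
  have hfix (x) : a (ι x) = ι x := (hιa _).1 ⟨x, rfl⟩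
  have hpow (k : ℕ) (g : G) (x : W) :
      (a ^ k) (ρ g (ι x)) = (powChar ν z g⁻¹ : ℂ) ^ k • ρ g (ι x) := by
    induction k with
    | zero => simp
    | succ k ih =>
      rw [pow_succ', Module.End.mul_apply, ih, map_smul, ha', hfix, pow_succ, Units.smul_def,
        smul_smul, map_inv]
  have hP1 (h : H) (x) : P (ρ h (ι x)) = σ h x := by
    apply hι
    rw [hP, hισ, hp]
    simp only [hpow, (powChar_eq_one_iff hz hH _).2 (H.inv_mem h.2)]
    simp [← Nat.cast_smul_eq_nsmul ℂ, smul_smul, ht0]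
  have hP0 (g : G) (hg : g ∉ H) (x) : P (ρ g (ι x)) = 0 := by
    apply hι
    rw [hP, hp]
    simp only [hpow, ← Finset.sum_smul]
    rw [sum_powChar_pow hz hH _ (by rwa [H.inv_mem_iff])]
    simp
  -- The map given by Frobenius reciprocity; the inverse appears because `G` acts on `IndV.mk g x`
  -- by right multiplication of `g` by inverses.
  let ψ : IndV H.subtype σ →ₗ[ℂ] V := indLift (fun g => ρ g⁻¹ ∘ₗ ι) fun h g x => by
    rw [LinearMap.comp_apply, hισ, mul_inv_rev, map_mul, Module.End.mul_apply, hinv]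
    rfl
  have hψ (g x) : ψ (IndV.mk H.subtype σ g x) = ρ g⁻¹ (ι x) := by rw [indLift_mk]; rfl
  have hψρ (g y) : ψ (ind H.subtype σ g y) = ρ g (ψ y) := by
    induction y using indV_induction with
    | h0 => simp
    | hadd x y hx hy => simp only [map_add, hx, hy]
    | hmk g' a => rw [ind_mk, hψ, hψ, mul_inv_rev, inv_inv, map_mul, Module.End.mul_apply]
  -- A left inverse of `ψ`: the powers `Φ ^ j` with `j < t` represent the cosets of `H`.
  let θ : V →ₗ[ℂ] IndV H.subtype σ :=
    ∑ j ∈ Finset.range t, IndV.mk H.subtype σ (Φ ^ j) ∘ₗ P ∘ₗ ρ (Φ ^ j)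
  have hνΦ (j : ℕ) : (ν (Φ ^ j)).toAdd = j := by rw [map_pow, hΦ, ← ofAdd_nsmul]; simp
  have hθψ (y) : θ (ψ y) = y := by
    induction y using indV_induction with
    | h0 => simp
    | hadd x y hx hy => simp only [map_add, hx, hy]
    | hmk g x =>
      rw [hψ]
      have hm (j : ℕ) : ρ (Φ ^ j) (ρ g⁻¹ (ι x)) = ρ (Φ ^ j * g⁻¹) (ι x) := by
        rw [map_mul, Module.End.mul_apply]
      have hθ : θ (ρ g⁻¹ (ι x)) =
          ∑ j ∈ Finset.range t, IndV.mk H.subtype σ (Φ ^ j) (P (ρ (Φ ^ j * g⁻¹) (ι x))) := by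
        simp only [← hm]
        exact LinearMap.sum_apply _ _ _
      rw [hθ]
      set n : ℤ := (ν g).toAdd with hn
      have htz : (t : ℤ) ≠ 0 := by exact_mod_cast ht.ne'
      have hνj (j : ℕ) : (ν (Φ ^ j * g⁻¹)).toAdd = j - n := by
        rw [map_mul, map_inv, toAdd_mul, hνΦ, toAdd_inv, sub_eq_add_neg]
      -- The residue of the degree of `g` modulo `t` is the only `j < t` with `Φ ^ j * g⁻¹ ∈ H`, so
      -- only this term of `θ` survives.
      obtain ⟨j, hj⟩ := Int.eq_ofNat_of_zero_le (Int.emod_nonneg n htz)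
      have hjt : j < t := by
        have := Int.emod_lt_of_pos n (b := (t : ℤ)) (by omega)
        omega
      have hdvd : (t : ℤ) ∣ j - n := by
        have := Int.dvd_self_sub_emod (x := n) (m := t)
        rwa [← Int.dvd_neg, neg_sub, hj] at this
      rw [Finset.sum_eq_single j]
      · have hmem : Φ ^ j * g⁻¹ ∈ H := (hH _).2 (by rw [hνj]; exact hdvd)
        rw [hP1 ⟨_, hmem⟩, ← indV_mk_mul ⟨_, hmem⟩ g x]
        simp
      · intro i hi hij
        rw [hP0, map_zero]
        rw [hH, hνj]
        intro hi'
        have h3 := Int.dvd_sub hi' hdvd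
        rw [sub_sub_sub_cancel_right] at h3
        have hi2 := Finset.mem_range.1 hi
        have := Int.eq_zero_of_abs_lt_dvd h3 (by rw [abs_lt]; omega)
        omega
      · intro h; exact absurd (Finset.mem_range.2 hjt) h
  have hW : ∃ x : W, ι x ≠ 0 := by
    have := IsIrreducible.nontrivial hirr
    obtain ⟨v, hv0, hv⟩ := ha.exists_fixed hΦ ht hz hat
    obtain ⟨x, rfl⟩ := (hιa v).2 hv
    exact ⟨x, hv0⟩
  -- The range is stable under `G`, and it is nonzero because `a` has a nonzero fixed vector.
  have hsurj : Function.Surjective ψ := by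
    rw [← LinearMap.range_eq_top]
    refine (eq_bot_or_eq_top_of_invariant hirr _ ?_).resolve_left ?_
    · rintro g _ ⟨y, rfl⟩
      exact ⟨_, hψρ g y⟩
    · intro h
      obtain ⟨x, hx⟩ := hW
      apply hx
      have : ψ (IndV.mk H.subtype σ 1 x) = 0 := by
        rw [← Submodule.mem_bot ℂ, ← h]; exact ⟨_, rfl⟩
      rw [hψ] at this
      simpa using this
  let e : IndV H.subtype σ ≃ₗ[ℂ] V :=
    LinearEquiv.ofBijective ψ ⟨Function.LeftInverse.injective hθψ, hsurj⟩
  exact ⟨(Representation.Equiv.mk (σ := ρ) e fun g => LinearMap.ext fun y => hψρ g y).symm⟩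

end Ind

/-! ### Adjoints with respect to an invariant form. -/

section Forms

variable {G : Type*} [Group G] {V : Type*} [AddCommGroup V] [Module ℂ V] 
  {ρ : Representation ℂ G V} {B : LinearMap.BilinForm ℂ V}

lemma form_apply_left (hinv : ∀ g x y, B (ρ g x) (ρ g y) = B x y) (g : G) (x y : V) :
    B (ρ g x) y = B x (ρ g⁻¹ y) := by
  rw [← hinv g x]
  congr 1
  rw [← Module.End.mul_apply, ← map_mul]; simp

lemma form_pow_apply {b : Module.End ℂ V} {ε : ℂ} (hb : ∀ x y, B (b x) y = ε * B x (b y)) (k : ℕ)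
    (x y : V) : B ((b ^ k) x) y = ε ^ k * B x ((b ^ k) y) := by
  induction k generalizing x with
  | zero => simp
  | succ k ih =>
    rw [pow_succ, Module.End.mul_apply, ih, hb, ← Module.End.mul_apply, ← pow_succ', pow_succ,
      pow_succ, mul_assoc, Module.End.mul_apply]

variable [FiniteDimensional ℂ V]

lemma eq_of_forall_form_eq (hB : B.Nondegenerate) {x y : V} (h : ∀ z, B x z = B y z) : x = y :=
  (B.toDual hB).injective (LinearMap.ext fun z => h z)

lemma eq_of_forall_form_eq' (hB : B.Nondegenerate) {s : ℂ}
    (hsymm : ∀ x y, B y x = s * B x y) {x y : V} (h : ∀ z, B z x = B z y) : x = y :=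
  eq_of_forall_form_eq hB fun z => by rw [hsymm z x, hsymm z y, h]

lemma exists_form_eq (hB : B.Nondegenerate) (β : LinearMap.BilinForm ℂ V) :
    ∃ a : Module.End ℂ V, ∀ x y, B (a x) y = β x y :=
  ⟨(B.toDual hB).symm.toLinearMap ∘ₗ β, fun x y => by
    rw [← LinearMap.BilinForm.toDual_def hB]
    simp⟩

/-- Invariance of `B` makes the adjoint `b'` of `b` a twist for the same character, so `b' = c • b`
by Schur. Taking adjoints twice is the identity, whence `c * c = 1`. -/
theorem IsTwist.exists_sign (hirr : ρ.IsIrreducible) (hB : B.Nondegenerate)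
    (hinv : ∀ g x y, B (ρ g x) (ρ g y) = B x y) {s : ℂ} (hs : s * s = 1)
    (hsymm : ∀ x y, B y x = s * B x y) {χ : G →* ℂˣ} {b : Module.End ℂ V} (hb : IsTwist ρ χ b)
    (hb0 : b ≠ 0) : ∃ ε : ℂ, (ε = 1 ∨ ε = -1) ∧ ∀ x y, B (b x) y = ε * B x (b y) := by
  obtain ⟨b', hb'⟩ := exists_form_eq hB (B.compl₁₂ LinearMap.id b)
  have hadj (x y) : B (b x) y = B x (b' y) := by
    have h1 : B (b' y) x = B y (b x) := hb' y x
    rw [hsymm (b' y) x, h1, hsymm y (b x)]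
  have hcomm (g : G) (x : V) : ρ g (b x) = (χ g : ℂ) • b (ρ g x) := LinearMap.congr_fun (hb g) x
  have hb't : IsTwist ρ χ b' := fun g => LinearMap.ext fun y => by
    refine eq_of_forall_form_eq' hB hsymm fun x => ?_
    rw [Module.End.mul_apply, LinearMap.smul_apply, Module.End.mul_apply, map_smul, ← hadj,
      ← hinv g⁻¹ x, ← hinv g⁻¹ (b x), hcomm]
    rw [← Module.End.mul_apply, ← map_mul, inv_mul_cancel, map_one, ← Module.End.mul_apply (ρ g⁻¹),
      ← map_mul, inv_mul_cancel, map_one, Module.End.one_apply, Module.End.one_apply, ← hadj,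
      map_smul, LinearMap.smul_apply, smul_smul, ← Units.val_mul, ← map_mul, mul_inv_cancel,
      map_one, Units.val_one, one_smul]
  obtain ⟨c, rfl⟩ := hb.exists_eq_smul hirr hb0 hb't
  have h1 (x y) : B (b x) y = c * B x (b y) := by rw [hadj]; simp
  refine ⟨c, ?_, h1⟩
  obtain ⟨x, hx⟩ : ∃ x, b x ≠ 0 := by
    by_contra! h
    exact hb0 (LinearMap.ext h)
  obtain ⟨y, hy⟩ : ∃ y, B (b x) y ≠ 0 := by
    by_contra! h
    exact hx (eq_of_forall_form_eq hB fun z => by rw [h]; simp)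
  have h2 : B (b x) y = c * c * B (b x) y := by
    conv_lhs => rw [h1, hsymm (b y) x, h1, hsymm (b x) y]
    linear_combination (c * c * B (b x) y) * hs
  have h3 : (c - 1) * (c + 1) = 0 := by
    apply mul_right_cancel₀ hy
    linear_combination -h2
  rcases mul_eq_zero.1 h3 with h | h
  · exact Or.inl (sub_eq_zero.1 h)
  · exact Or.inr (eq_neg_of_add_eq_zero_left h)

/-- `a` is skew-adjoint for `B`. -/
def IsSkew (B : LinearMap.BilinForm ℂ V) (a : Module.End ℂ V) : Prop :=
  ∀ x y, B (a x) y = - B x (a y)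

/-- Polynomials in a self-adjoint `b` are self-adjoint, and an endomorphism both self-adjoint and
skew vanishes. -/
lemma IsSkew.eq_zero (hB : B.Nondegenerate) {a b : Module.End ℂ V} {d : ℕ}
    (hb : ∀ x y, B (b x) y = B x (b y)) (ha : IsSkew B a)
    (hspan : a ∈ Submodule.span ℂ (Set.range fun k : Fin d => b ^ (k : ℕ))) : a = 0 := by
  have hsymm : ∀ x y, B (a x) y = B x (a y) := by
    clear ha
    induction hspan using Submodule.span_induction with
    | mem a ha =>
      obtain ⟨k, rfl⟩ := ha
      intro x y
      simpa using form_pow_apply (ε := 1) (by simpa using hb) k x y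
    | zero => simp
    | add a a' _ _ h h' => intro x y; simp [h, h']
    | smul c a _ h => intro x y; simp [h]
  refine LinearMap.ext fun x => eq_of_forall_form_eq hB fun y => ?_
  have h1 := ha x y
  have h2 := hsymm x y
  rw [← h2] at h1
  rw [LinearMap.zero_apply, map_zero, LinearMap.zero_apply]
  exact self_eq_neg.1 h1

end Forms

/-! ### Skew-adjoint polynomials in a skew-adjoint endomorphism. -/

section Skew

variable {V : Type*} [AddCommGroup V] [Module ℂ V] [FiniteDimensional ℂ V]
  {B : LinearMap.BilinForm ℂ V} {a b : Module.End ℂ V} {d e : ℕ}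

lemma IsSkew.mem_span_odd (hB : B.Nondegenerate) (hb : ∀ x y, B (b x) y = - B x (b y))
    (hde : d = 2 * e) (ha : IsSkew B a)
    (hspan : a ∈ Submodule.span ℂ (Set.range fun k : Fin d => b ^ (k : ℕ))) :
    a ∈ Submodule.span ℂ (Set.range fun k : Fin e => b ^ (2 * (k : ℕ) + 1)) := by
  -- Here `a'` is the adjoint of `a`. Even powers of `b` are self-adjoint, so they cancel in `a -
  -- a'`, which equals `2a` when `a` is skew.
  obtain ⟨a', hmem, hadj⟩ : ∃ a' : Module.End ℂ V,
      a - a' ∈ Submodule.span ℂ (Set.range fun k : Fin e => b ^ (2 * (k : ℕ) + 1)) ∧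
      ∀ x y, B (a' x) y = B x (a y) := by
    clear ha
    induction hspan using Submodule.span_induction with
    | mem a ha =>
      obtain ⟨k, rfl⟩ := ha
      have h1 := form_pow_apply (ε := -1) (by simpa using hb) k
      refine ⟨(-1 : ℂ) ^ (k : ℕ) • b ^ (k : ℕ), ?_, fun x y => ?_⟩
      · rcases Nat.even_or_odd (k : ℕ) with h | h
        · rw [h.neg_one_pow, one_smul, sub_self]
          exact Submodule.zero_mem _
        · obtain ⟨j, hj⟩ := h
          have hodd : Odd (k : ℕ) := ⟨j, hj⟩
          rw [hodd.neg_one_pow, neg_one_smul, sub_neg_eq_add, ← two_smul ℂ]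
          refine Submodule.smul_mem _ _ (Submodule.subset_span ⟨⟨j, by omega⟩, ?_⟩)
          simp only [hj]
      · rw [LinearMap.smul_apply, map_smul, LinearMap.smul_apply, h1, smul_eq_mul, ← mul_assoc,
          ← mul_pow]
        simp
    | zero => exact ⟨0, by simp, by simp⟩
    | add a₁ a₂ _ _ h₁ h₂ =>
      obtain ⟨a₁', h₁, h₁'⟩ := h₁
      obtain ⟨a₂', h₂, h₂'⟩ := h₂
      refine ⟨a₁' + a₂', ?_, fun x y => by simp [h₁', h₂']⟩
      rw [add_sub_add_comm]
      exact Submodule.add_mem _ h₁ h₂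
    | smul c a₁ _ h₁ =>
      obtain ⟨a₁', h₁, h₁'⟩ := h₁
      refine ⟨c • a₁', ?_, fun x y => by simp [h₁']⟩
      rw [← smul_sub]
      exact Submodule.smul_mem _ _ h₁
  have ha' : a' = -a := LinearMap.ext fun x => eq_of_forall_form_eq hB fun y => by
    rw [hadj, LinearMap.neg_apply, map_neg, LinearMap.neg_apply, ha x y, neg_neg]
  rw [ha', sub_neg_eq_add, ← two_smul ℂ] at hmem
  exact (Submodule.smul_mem_iff _ two_ne_zero).1 hmem

end Skew

/-! ### Characteristic determinants from an explicit eigenbasis. -/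

section Det

variable {U : Type*} [AddCommGroup U] [Module ℂ U]

lemma det_one_sub_smul_of_eigenbasis {n : ℕ} (T : Module.End ℂ U) (u : Fin n → U) (μ : Fin n → ℂ)
    (hμ : Function.Injective μ) (hu : ∀ k, u k ≠ 0) (hT : ∀ k, T (u k) = μ k • u k)
    (hspan : ⊤ ≤ Submodule.span ℂ (Set.range u)) (X : ℂ) :
    LinearMap.det (1 - X • T) = ∏ k, (1 - X * μ k) := by
  have hli : LinearIndependent ℂ u := Module.End.eigenvectors_linearIndependent' T μ hμ u
    fun k => ⟨Module.End.mem_eigenspace_iff.2 (hT k), hu k⟩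
  let bas := Module.Basis.mk hli hspan
  have : LinearMap.toMatrix bas bas (1 - X • T) = Matrix.diagonal fun k => 1 - X * μ k := by
    ext i j
    rw [LinearMap.toMatrix_apply, Matrix.diagonal_apply]
    have h1 : (1 - X • T) (bas j) = (1 - X * μ j) • bas j := by
      simp [bas, hT, sub_smul, smul_smul]
    rw [h1, map_smul, Finsupp.smul_apply, Module.Basis.repr_self, Finsupp.single_apply]
    by_cases h : i = j
    · simp [h]
    · simp [h, Ne.symm h]
  rw [← LinearMap.det_toMatrix bas, this, Matrix.det_diagonal]

/-- The powers of `w ^ 2` are all the `e`-th roots of unity, so the product is `1 - (X * w) ^ e`,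
and `w ^ e = -1`. -/
lemma prod_one_sub_odd_pow {w : ℂ} {e : ℕ} (he : 0 < e) (hw : IsPrimitiveRoot w (2 * e)) (X : ℂ) :
    ∏ k : Fin e, (1 - X * w ^ (2 * (k : ℕ) + 1)) = 1 + X ^ e := by
  have hw2 : IsPrimitiveRoot (w ^ 2) e := hw.pow (by omega) rfl
  have hwe : w ^ e = -1 := by
    have h1 : w ^ e * w ^ e = 1 := by rw [← pow_add, ← two_mul]; exact hw.pow_eq_one
    exact (mul_self_eq_one_iff.1 h1).resolve_left (hw.pow_ne_one_of_pos_of_lt he.ne' (by omega))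
  have h1 := hw2.pow_sub_pow_eq_prod_sub_mul 1 (X * w) he
  rw [one_pow, mul_pow, hwe, mul_neg_one, sub_neg_eq_add] at h1
  have : NeZero e := ⟨he.ne'⟩
  rw [h1, Fin.prod_univ_eq_prod_range (fun k => 1 - X * w ^ (2 * k + 1)) e]
  refine Finset.prod_nbij (fun k => (w ^ 2) ^ k) (fun k _ => ?_) (fun k hk l hl h => ?_)
    (fun ζ hζ => ?_) fun k _ => by ring
  · rw [Polynomial.mem_nthRootsFinset he, ← pow_mul, mul_comm, pow_mul, hw2.pow_eq_one, one_pow]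
  · exact hw2.pow_inj (Finset.mem_range.1 hk) (Finset.mem_range.1 hl) h
  · rw [Finset.mem_coe, Polynomial.mem_nthRootsFinset he] at hζ
    obtain ⟨k, hk, rfl⟩ := hw2.eq_pow_of_pow_eq_one hζ
    exact ⟨k, Finset.mem_coe.2 (Finset.mem_range.2 hk), rfl⟩

end Det

/-! ### Self-duality of the inducing representation is read off from the sign of the twist. -/

section SelfDual

variable {G : Type*} [Group G] {V : Type*} [AddCommGroup V] [Module ℂ V] [FiniteDimensional ℂ V]
  {ρ : Representation ℂ G V} {B : LinearMap.BilinForm ℂ V} {H : Subgroup G}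
  {W : Type*} [AddCommGroup W] [Module ℂ W] {σ : Representation ℂ H W}
  {ν : G →* Multiplicative ℤ} {d : ℕ} {w : ℂˣ}

/-- The restriction of `B` to `W` is nondegenerate. Pairing with a vector fixed by the self-adjoint
twist is unchanged when the other argument is averaged over the twist, so a vector orthogonal to `W`
is orthogonal to all of `V`. -/
lemma InducingData.isSelfDual [FiniteDimensional ℂ W] (D : InducingData ρ σ ν w d) (hd : 0 < d)
    (hB : B.Nondegenerate) (hinv : ∀ g x y, B (ρ g x) (ρ g y) = B x y)
    (hb : ∀ x y, B (D.twist x) y = B x (D.twist y)) : IsSelfDual σ := by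
  let T : W →ₗ[ℂ] Module.Dual ℂ W := B.compl₁₂ D.incl D.incl
  have hT (x y) : T x y = B (D.incl x) (D.incl y) := rfl
  have hinj : Function.Injective T := by
    rw [injective_iff_map_eq_zero]
    intro x hx
    rw [← D.proj_incl x]
    have : D.incl x = 0 := eq_of_forall_form_eq hB fun v => by
      have h1 (k : ℕ) : B (D.incl x) ((D.twist ^ k) v) = B (D.incl x) v := by
        have h2 := form_pow_apply (ε := 1) (by simpa using hb) k (D.incl x) v
        have h3 : (D.twist ^ k) (D.incl x) = D.incl x := by
          induction k with
          | zero => simp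
          | succ k ih =>
            rw [pow_succ, Module.End.mul_apply, D.twist_incl]
            exact ih (by simpa using form_pow_apply (ε := 1) (by simpa using hb) k (D.incl x) v)
        rw [h3, one_pow, one_mul] at h2
        exact h2.symm
      have h2 := congrArg (B (D.incl x)) (D.sum_twist v)
      rw [map_sum, map_smul, ← hT, hx] at h2
      simp only [h1] at h2
      simpa [hd.ne'] using h2
    rw [this, map_zero]
  let e := LinearMap.linearEquivOfInjective T hinj Subspace.dual_finrank_eq.symm
  refine ⟨Representation.Equiv.mk (σ := σ.dual) e fun h => LinearMap.ext fun x =>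
    LinearMap.ext fun y => ?_⟩
  change T (σ h x) y = T x (σ h⁻¹ y)
  rw [hT, hT, D.incl_apply, D.incl_apply, form_apply_left hinv]
  rfl

/-- An invariant form on `W`, extended to `V` through `proj`, corresponds to an endomorphism `a` in
the commutant. Hence `a` commutes with the twist, and moving the skew twist across `B` between
vectors it fixes shows that the form equals its own negative. -/
lemma InducingData.not_isSelfDual [Nontrivial V] (D : InducingData ρ σ ν w d) (hd : 0 < d)
    (hw : orderOf w = d) {Φ : G} (hΦ : ν Φ = Multiplicative.ofAdd 1)
    (hH : ∀ g, ν g = 1 → g ∈ H) (hB : B.Nondegenerate)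
    (hinv : ∀ g x y, B (ρ g x) (ρ g y) = B x y)
    (hb : ∀ x y, B (D.twist x) y = - B x (D.twist y))
    (hspan : kerCommutant ρ ν ≤ Submodule.span ℂ (Set.range fun k : Fin d => D.twist ^ (k : ℕ))) :
    ¬ IsSelfDual σ := by
  rintro ⟨T⟩
  have hTσ (h x y) : T (σ h x) (σ h y) = T x y := by
    have h1 : T (σ h x) = σ.dual h (T x) := LinearMap.congr_fun (T.isIntertwining' h) x
    rw [h1]
    change T x (σ h⁻¹ (σ h y)) = _
    rw [← Module.End.mul_apply, ← map_mul]; simp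
  obtain ⟨a, ha⟩ := exists_form_eq hB
    ((T.toLinearEquiv.toLinearMap : W →ₗ[ℂ] Module.Dual ℂ W).compl₁₂ D.proj D.proj)
  replace ha : ∀ x y, B (a x) y = T (D.proj x) (D.proj y) := ha
  have hmem : a ∈ kerCommutant ρ ν := fun g hg => LinearMap.ext fun x =>
    eq_of_forall_form_eq hB fun y => by
      have hg' : g⁻¹ ∈ H := H.inv_mem (hH g hg)
      rw [Module.End.mul_apply, Module.End.mul_apply, form_apply_left hinv, ha, ha,
        D.proj_apply ⟨g, hH g hg⟩, D.proj_apply ⟨g⁻¹, hg'⟩, ← hTσ ⟨g, hH g hg⟩,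
        ← Module.End.mul_apply, ← map_mul]
      have : (⟨g, hH g hg⟩ : H) * ⟨g⁻¹, hg'⟩ = 1 := by ext; simp
      rw [this, map_one]
      rfl
  have hcomm : a * D.twist = D.twist * a := by
    have := hspan hmem
    clear hmem ha
    induction this using Submodule.span_induction with
    | mem a ha => obtain ⟨k, rfl⟩ := ha; exact ((Commute.refl D.twist).pow_left _).eq
    | zero => simp
    | add a₁ a₂ _ _ h₁ h₂ => rw [add_mul, mul_add, h₁, h₂]
    | smul c a₁ _ h₁ => rw [smul_mul_assoc, mul_smul_comm, h₁]
  have hT0 (x y : W) : T x y = 0 := by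
    have h1 : B (a (D.incl x)) (D.incl y) = T x y := by rw [ha, D.proj_incl, D.proj_incl]
    have h2 : B (a (D.incl x)) (D.incl y) = - B (a (D.incl x)) (D.incl y) := by
      conv_lhs => rw [← D.twist_incl x, ← Module.End.mul_apply, hcomm, Module.End.mul_apply, hb,
        D.twist_incl]
    rw [← h1]
    exact self_eq_neg.1 h2
  have hW (x : W) : x = 0 := T.toLinearEquiv.injective (LinearMap.ext fun y => by
    rw [map_zero]; exact hT0 x y)
  -- The form on `W` is zero and yet injective, so `W = 0`; this contradicts the existence of a
  -- nonzero vector fixed by the twist.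
  obtain ⟨v, hv0, hv⟩ := D.isTwist.exists_fixed hΦ hd hw D.twist_pow
  have hk (k : ℕ) : (D.twist ^ k) v = v := by
    induction k with
    | zero => simp
    | succ k ih => rw [pow_succ, Module.End.mul_apply, hv, ih]
  have h1 := D.sum_twist v
  rw [hW (D.proj v), map_zero, smul_zero] at h1
  simp only [hk, Finset.sum_const, Finset.card_range, ← Nat.cast_smul_eq_nsmul ℂ] at h1
  rcases smul_eq_zero.1 h1 with h | h
  · exact hd.ne' (Nat.cast_eq_zero.1 h)
  · exact hv0 h

end SelfDual

/-! ### The determinant on the invariants of the skew-adjoint model. -/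

section LFactor

variable {G : Type*} [Group G] {V : Type*} [AddCommGroup V] [Module ℂ V]
  {ρ : Representation ℂ G V} {B : LinearMap.BilinForm ℂ V} {N : Subgroup G}
  {ν : G →* Multiplicative ℤ} {d e : ℕ} {w : ℂˣ} {b : Module.End ℂ V}
  {P : Type*} [AddCommGroup P] [Module ℂ P]

/-- `j` identifies the representation `π` with the skew-adjoint endomorphisms of `ρ`. -/
structure IsSkewModel (ρ : Representation ℂ G V) (B : LinearMap.BilinForm ℂ V)
    (π : Representation ℂ G P) (j : P →ₗ[ℂ] Module.End ℂ V) : Prop where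
  injective : Function.Injective j
  map_apply : ∀ g x, j (π g x) = ρ g * j x * ρ g⁻¹
  isSkew : ∀ x, IsSkew B (j x)
  exists_of_isSkew : ∀ a, IsSkew B a → ∃ x, j x = a

variable {π : Representation ℂ G P} {j : P →ₗ[ℂ] Module.End ℂ V}

lemma IsSkewModel.mem_kerCommutant (hj : IsSkewModel ρ B π j) (hN : ∀ g, g ∈ N ↔ ν g = 1)
    {x : P} : x ∈ (Representation.invariants (π.comp N.subtype)) ↔ j x ∈ kerCommutant ρ ν := by
  have hinv (g : G) : ρ g * ρ g⁻¹ = 1 := by rw [← map_mul]; simp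
  have hinv' (g : G) : ρ g⁻¹ * ρ g = 1 := by rw [← map_mul]; simp
  have key (g : G) : π g x = x ↔ ρ g * j x = j x * ρ g := by
    rw [← hj.injective.eq_iff, hj.map_apply]
    constructor
    · intro h
      nth_rewrite 2 [← h]
      rw [mul_assoc, hinv', mul_one]
    · intro h
      rw [h, mul_assoc, hinv, mul_one]
  constructor
  · intro h g hg
    exact (key g).1 (h ⟨g, (hN g).2 hg⟩)
  · intro h g
    exact (key g).2 (h g ((hN g).1 g.2))

variable [N.Normal] [FiniteDimensional ℂ V]

theorem IsSkewModel.det_eq_one (hj : IsSkewModel ρ B π j) (hN : ∀ g, g ∈ N ↔ ν g = 1)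
    (hB : B.Nondegenerate) (hb : ∀ x y, B (b x) y = B x (b y))
    (hspan : kerCommutant ρ ν ≤ Submodule.span ℂ (Set.range fun k : Fin d => b ^ (k : ℕ)))
    (Φ : G) (X : ℂ) : LinearMap.det (1 - X • π.toInvariants N Φ) = 1 := by
  have : Subsingleton (Representation.invariants (π.comp N.subtype)) := by
    rw [Submodule.subsingleton_iff_eq_bot, eq_bot_iff]
    intro x hx
    rw [Submodule.mem_bot]
    apply hj.injective
    rw [map_zero]
    exact (hj.isSkew x).eq_zero hB hb (hspan ((hj.mem_kerCommutant hN).1 hx))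
  exact LinearMap.det_eq_one_of_subsingleton _

/-- The odd powers `b ^ (2k + 1)` with `k < e` form a basis of the invariants, and `Φ` acts on them
by the distinct eigenvalues `w ^ (2k + 1)`. -/
theorem IsSkewModel.det_eq_one_add_pow (hj : IsSkewModel ρ B π j) (hN : ∀ g, g ∈ N ↔ ν g = 1)
    (hB : B.Nondegenerate) (hb : ∀ x y, B (b x) y = - B x (b y)) (hb0 : IsUnit b)
    (hbt : IsTwist ρ (powChar ν w) b) (he : 0 < e) (hde : d = 2 * e) (hw : orderOf w = d)
    (hspan : kerCommutant ρ ν ≤ Submodule.span ℂ (Set.range fun k : Fin d => b ^ (k : ℕ)))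
    [Nontrivial V] {Φ : G} (hΦ : ν Φ = Multiplicative.ofAdd 1) (X : ℂ) :
    LinearMap.det (1 - X • π.toInvariants N Φ) = 1 + X ^ e := by
  have hwp : IsPrimitiveRoot (w : ℂ) (2 * e) :=
    (hde ▸ hw ▸ IsPrimitiveRoot.orderOf w : IsPrimitiveRoot w (2 * e)).map_of_injective
      (f := Units.coeHom ℂ) Units.val_injective
  have hskew (k : ℕ) : IsSkew B (b ^ (2 * k + 1)) := fun x y => by
    have := form_pow_apply (ε := -1) (by simpa using hb) (2 * k + 1) x y
    rw [this, Odd.neg_one_pow ⟨k, rfl⟩, neg_one_mul]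
  choose u hu using fun k : ℕ => hj.exists_of_isSkew _ (hskew k)
  have hmem (k : ℕ) : u k ∈ (Representation.invariants (π.comp N.subtype)) := by
    rw [hj.mem_kerCommutant hN, hu]
    have := hbt.pow (2 * k + 1)
    rw [← powChar_pow] at this
    exact this.mem_kerCommutant
  rw [← prod_one_sub_odd_pow he hwp]
  refine det_one_sub_smul_of_eigenbasis _ (fun k : Fin e => ⟨u k, hmem k⟩)
    (fun k => (w : ℂ) ^ (2 * (k : ℕ) + 1)) ?_ ?_ ?_ ?_ X
  · intro k l h
    have := hwp.pow_inj (by omega) (by omega) h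
    ext
    omega
  · intro k h
    have h1 := hu k
    rw [show u k = 0 from congrArg Subtype.val h] at h1
    exact (hb0.pow (2 * (k : ℕ) + 1)).ne_zero (by rw [← h1]; simp)
  · intro k
    ext
    apply hj.injective
    change j (π Φ (u k)) = j ((w : ℂ) ^ (2 * (k : ℕ) + 1) • u k)
    rw [hj.map_apply, map_smul, hu]
    have h1 := hbt.pow (2 * (k : ℕ) + 1) Φ
    rw [h1, ← powChar_pow, powChar_apply, hΦ, smul_mul_assoc, mul_assoc, ← map_mul]
    simp
  · rintro ⟨x, hx⟩ -
    have h1 := (hj.isSkew x).mem_span_odd hB hb hde (hspan ((hj.mem_kerCommutant hN).1 hx))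
    have hinj : Function.Injective (j ∘ₗ (Representation.invariants (π.comp N.subtype)).subtype) :=
      hj.injective.comp Subtype.val_injective
    have h2 : (fun k : Fin e => b ^ (2 * (k : ℕ) + 1)) =
        (j ∘ₗ (Representation.invariants (π.comp N.subtype)).subtype) ∘
          fun k : Fin e => ⟨u k, hmem k⟩ := funext fun k => (hu k).symm
    rw [h2, Set.range_comp, ← Submodule.map_span] at h1
    obtain ⟨y, hy, hyx⟩ := h1
    rwa [← hinj (a₁ := y) (a₂ := ⟨x, hx⟩) hyx]

end LFactor

/-! ### Exterior and symmetric squares as spaces of skew-adjoint endomorphisms. -/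

section Models

variable {G : Type*} [Group G] {V : Type*} [AddCommGroup V] [Module ℂ V]
  {ρ : Representation ℂ G V} {B : LinearMap.BilinForm ℂ V}
  {P : Type*} [AddCommGroup P] [Module ℂ P] {π : Representation ℂ G P}

section Tensor

variable [FiniteDimensional ℂ V]

/-- The isomorphism of `V ⊗ V` and `End V` given by a nondegenerate form. -/
def formTensorEquiv (hB : B.Nondegenerate) : V ⊗[ℂ] V ≃ₗ[ℂ] Module.End ℂ V :=
  TensorProduct.comm ℂ V V ≪≫ₗ
    TensorProduct.congr (B.toDual hB) (LinearEquiv.refl ℂ V) ≪≫ₗ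
      dualTensorHomEquivOfBasis (Module.finBasis ℂ V)

lemma formTensorEquiv_tmul (hB : B.Nondegenerate) (x y z : V) :
    formTensorEquiv hB (x ⊗ₜ y) z = B y z • x := by
  simp [formTensorEquiv, dualTensorHomEquivOfBasis_apply, LinearMap.BilinForm.toDual_def hB]

lemma formTensorEquiv_map (hB : B.Nondegenerate) (hinv : ∀ g x y, B (ρ g x) (ρ g y) = B x y)
    (g : G) (t : V ⊗[ℂ] V) : formTensorEquiv hB (TensorProduct.map (ρ g) (ρ g) t) =
      ρ g * formTensorEquiv hB t * ρ g⁻¹ := by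
  induction t using TensorProduct.induction_on with
  | zero => simp
  | add x y hx hy => simp only [map_add, hx, hy, mul_add, add_mul]
  | tmul x y =>
    refine LinearMap.ext fun z => ?_
    rw [TensorProduct.map_tmul, formTensorEquiv_tmul, form_apply_left hinv, Module.End.mul_apply,
      Module.End.mul_apply, formTensorEquiv_tmul, map_smul]

/-- Taking adjoints corresponds to `s` times the swap of tensor factors. Skew-adjoint endomorphisms
thus come from antisymmetric tensors when `s = 1` and from symmetric tensors when `s = -1`. -/
lemma form_formTensorEquiv (hB : B.Nondegenerate) {s : ℂ} (hsymm : ∀ x y, B y x = s * B x y)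
    (t : V ⊗[ℂ] V) (z u : V) : B (formTensorEquiv hB t z) u =
      s * B z (formTensorEquiv hB (TensorProduct.comm ℂ V V t) u) := by
  induction t using TensorProduct.induction_on with
  | zero => simp
  | add x y hx hy => simp only [map_add, LinearMap.add_apply, hx, hy, mul_add]
  | tmul x y =>
    rw [TensorProduct.comm_tmul, formTensorEquiv_tmul, formTensorEquiv_tmul, map_smul, map_smul,
      LinearMap.smul_apply, smul_eq_mul, smul_eq_mul, hsymm z y]
    ring

/-- Treats both squares at once: `q` is the quotient map from the tensor square and `alt` the
(anti)symmetrisation back into it, inverse to `q` up to the factor `2`. -/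
theorem isSkewModel_of_tensor (hB : B.Nondegenerate)
    (hinv : ∀ g x y, B (ρ g x) (ρ g y) = B x y) {s : ℂ} (hs : s * s = 1)
    (hsymm : ∀ x y, B y x = s * B x y) (q : V ⊗[ℂ] V →ₗ[ℂ] P) (alt : P →ₗ[ℂ] V ⊗[ℂ] V)
    (hqalt : ∀ y, q (alt y) = (2 : ℂ) • y)
    (haltq : ∀ t, alt (q t) = t - s • TensorProduct.comm ℂ V V t)
    (hq : ∀ g t, q (TensorProduct.map (ρ g) (ρ g) t) = π g (q t)) :
    IsSkewModel ρ B π ((formTensorEquiv hB).toLinearMap ∘ₗ alt) := by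
  have hsurj (y : P) : ∃ t, q t = y :=
    ⟨(2 : ℂ)⁻¹ • alt y, by rw [map_smul, hqalt, smul_smul, inv_mul_cancel₀ two_ne_zero, one_smul]⟩
  have hcc (t : V ⊗[ℂ] V) : TensorProduct.comm ℂ V V (TensorProduct.comm ℂ V V t) = t :=
    (TensorProduct.comm ℂ V V).symm_apply_apply t
  have hcm (g : G) (t : V ⊗[ℂ] V) : TensorProduct.comm ℂ V V (TensorProduct.map (ρ g) (ρ g) t) =
      TensorProduct.map (ρ g) (ρ g) (TensorProduct.comm ℂ V V t) := by
    induction t using TensorProduct.induction_on with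
    | zero => simp
    | add x y hx hy => simp only [map_add, hx, hy]
    | tmul x y => simp
  have hsmul (c : ℂ) (a : Module.End ℂ V) (x : V) : (c • a) x = c • a x := rfl
  refine ⟨?_, fun g x => ?_, fun x z u => ?_, fun a ha => ?_⟩
  · refine (formTensorEquiv hB).injective.comp ?_
    rw [injective_iff_map_eq_zero]
    intro y hy
    have := hqalt y
    rw [hy, map_zero] at this
    exact (smul_eq_zero.1 this.symm).resolve_left two_ne_zero
  · obtain ⟨t, rfl⟩ := hsurj x
    rw [← hq]
    simp only [LinearMap.comp_apply, LinearEquiv.coe_coe, haltq]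
    rw [← formTensorEquiv_map hB hinv, map_sub (TensorProduct.map (ρ g) (ρ g)),
      map_smul (TensorProduct.map (ρ g) (ρ g)), hcm]
  · obtain ⟨t, rfl⟩ := hsurj x
    simp only [LinearMap.comp_apply, LinearEquiv.coe_coe, haltq]
    rw [form_formTensorEquiv hB hsymm, map_sub, map_smul, hcc, map_sub, map_sub, map_smul, map_smul,
      LinearMap.sub_apply, LinearMap.sub_apply, map_sub, map_sub, hsmul, hsmul, map_smul, map_smul,
      smul_eq_mul, smul_eq_mul]
    linear_combination -(B z (formTensorEquiv hB t u)) * hs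
  · obtain ⟨t, rfl⟩ := (formTensorEquiv hB).surjective a
    have ht : t = - s • TensorProduct.comm ℂ V V t := by
      apply (formTensorEquiv hB).injective
      refine LinearMap.ext fun z => eq_of_forall_form_eq hB fun u => ?_
      have h1 := form_formTensorEquiv hB hsymm (TensorProduct.comm ℂ V V t) z u
      rw [hcc] at h1
      rw [ha z u, map_smul, hsmul, map_smul, LinearMap.smul_apply, h1, smul_eq_mul]
      linear_combination (B z (formTensorEquiv hB t u)) * hs
    -- Skewness gives `t = -s • swap t`, so `alt (q t) = 2 • t`.
    refine ⟨(2 : ℂ)⁻¹ • q t, ?_⟩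
    simp only [LinearMap.comp_apply, LinearEquiv.coe_coe, map_smul, haltq]
    rw [← map_smul]
    congr 1
    rw [inv_smul_eq_iff₀ two_ne_zero, sub_eq_add_neg, ← neg_smul, ← ht, two_smul]

end Tensor

lemma update_pair_zero {α : Type*} (x y z : α) : Function.update ![x, y] 0 z = ![z, y] := by
  ext i; fin_cases i <;> rfl

lemma update_pair_one {α : Type*} (x y z : α) : Function.update ![x, y] 1 z = ![x, z] := by
  ext i; fin_cases i <;> rfl

/-- A multilinear map in two variables as a linear map on the tensor square. -/
def tensorOfMultilinear (f : MultilinearMap ℂ (fun _ : Fin 2 => V) P) : V ⊗[ℂ] V →ₗ[ℂ] P :=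
  TensorProduct.lift <| LinearMap.mk₂ ℂ (fun x y => f ![x, y])
    (fun x x' y => by simpa only [update_pair_zero] using f.map_update_add ![x, y] 0 x x')
    (fun c x y => by simpa only [update_pair_zero] using f.map_update_smul ![x, y] 0 c x)
    (fun x y y' => by simpa only [update_pair_one] using f.map_update_add ![x, y] 1 y y')
    (fun c x y => by simpa only [update_pair_one] using f.map_update_smul ![x, y] 1 c y)

lemma tensorOfMultilinear_tmul (f : MultilinearMap ℂ (fun _ : Fin 2 => V) P) (x y : V) :
    tensorOfMultilinear f (x ⊗ₜ y) = f ![x, y] := rfl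

/-- The multilinear map `(x, y) ↦ x ⊗ y - s • y ⊗ x`. -/
def symmetrizer (V : Type*) [AddCommGroup V] [Module ℂ V] (s : ℂ) :
    MultilinearMap ℂ (fun _ : Fin 2 => V) (V ⊗[ℂ] V) where
  toFun v := v 0 ⊗ₜ v 1 - s • v 1 ⊗ₜ v 0
  map_update_add' v i x y := by
    fin_cases i
    · simp [TensorProduct.add_tmul, TensorProduct.tmul_add]; abel
    · simp [TensorProduct.add_tmul, TensorProduct.tmul_add]; abel
  map_update_smul' v i c x := by
    fin_cases i
    · simp [TensorProduct.smul_tmul', smul_sub, smul_comm s c]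
    · simp [TensorProduct.smul_tmul', smul_sub, smul_comm s c]

lemma symmetrizer_apply (s : ℂ) (v : Fin 2 → V) :
    symmetrizer V s v = v 0 ⊗ₜ v 1 - s • v 1 ⊗ₜ v 0 := rfl

/-- The embedding `x ∧ y ↦ x ⊗ y - y ⊗ x` of the exterior square in the tensor square. -/
def extSqToTensor (V : Type*) [AddCommGroup V] [Module ℂ V] : ⋀[ℂ]^2 V →ₗ[ℂ] V ⊗[ℂ] V :=
  exteriorPower.alternatingMapLinearEquiv
    { symmetrizer V 1 with
      map_eq_zero_of_eq' := fun v i j hij hne => by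
        have : v 0 = v 1 := by
          fin_cases i <;> fin_cases j
          · exact absurd rfl hne
          · exact hij
          · exact hij.symm
          · exact absurd rfl hne
        change symmetrizer V 1 v = 0
        rw [symmetrizer_apply, this]; simp }

lemma extSqToTensor_ιMulti (v : Fin 2 → V) :
    extSqToTensor V (exteriorPower.ιMulti ℂ 2 v) = symmetrizer V 1 v :=
  exteriorPower.alternatingMapLinearEquiv_apply_ιMulti _ _

lemma exists_isSkewModel_extSq [FiniteDimensional ℂ V] (hB : B.Nondegenerate)
    (hinv : ∀ g x y, B (ρ g x) (ρ g y) = B x y) (hsymm : ∀ x y, B x y = B y x) :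
    ∃ j, IsSkewModel ρ B (extSq ρ) j := by
  refine ⟨_, isSkewModel_of_tensor hB hinv (s := 1) (by norm_num)
    (fun x y => by rw [one_mul, hsymm])
    (tensorOfMultilinear (exteriorPower.ιMulti ℂ 2).toMultilinearMap) (extSqToTensor V)
    (fun y => ?_) (fun t => ?_) fun g t => ?_⟩
  · refine LinearMap.congr_fun (f := tensorOfMultilinear _ ∘ₗ extSqToTensor V)
      (g := (2 : ℂ) • LinearMap.id) (exteriorPower.linearMap_ext (AlternatingMap.ext fun v => ?_)) y
    simp only [LinearMap.compAlternatingMap_apply, LinearMap.comp_apply, extSqToTensor_ιMulti,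
      symmetrizer_apply, map_sub, map_smul, tensorOfMultilinear_tmul,
        AlternatingMap.coe_multilinearMap]
    have h1 : ![v 0, v 1] = v := by ext i; fin_cases i <;> rfl
    have h2 : ![v 1, v 0] = v ∘ Equiv.swap 0 1 := by ext i; fin_cases i <;> rfl
    rw [h1, h2, AlternatingMap.map_swap _ _ (by decide)]
    simp [two_smul]
  · induction t using TensorProduct.induction_on with
    | zero => simp
    | add x y hx hy => simp only [map_add, hx, hy, smul_add]; abel
    | tmul x y =>
      rw [tensorOfMultilinear_tmul, AlternatingMap.coe_multilinearMap, extSqToTensor_ιMulti]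
      rfl
  · induction t using TensorProduct.induction_on with
    | zero => simp
    | add x y hx hy => simp only [map_add, hx, hy]
    | tmul x y =>
      rw [TensorProduct.map_tmul, tensorOfMultilinear_tmul, tensorOfMultilinear_tmul,
        AlternatingMap.coe_multilinearMap]
      change _ = exteriorPower.map 2 (ρ g) _
      rw [exteriorPower.map_apply_ιMulti]
      congr 1
      ext i; fin_cases i <;> rfl

/-- The embedding `x y ↦ x ⊗ y + y ⊗ x` of the symmetric square in the tensor square. -/
def symSqToTensor (V : Type*) [AddCommGroup V] [Module ℂ V] : Sym[ℂ]^2 V →ₗ[ℂ] V ⊗[ℂ] V where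
  __ := AddCon.lift (addConGen (SymmetricPower.Rel ℂ (Fin 2) V))
    (PiTensorProduct.lift (symmetrizer V (-1))).toAddMonoidHom
    (AddCon.addConGen_le.2 fun x y h => by
      obtain ⟨e, g⟩ := h
      have he : e = 1 ∨ e = Equiv.swap 0 1 := by
        revert e; decide
      rcases he with rfl | rfl
      · simp
      · simp [AddCon.ker_rel, symmetrizer_apply, add_comm])
  map_smul' r x := AddCon.induction_on x fun x => map_smul (PiTensorProduct.lift _) r x

lemma symSqToTensor_tprod (v : Fin 2 → V) :
    symSqToTensor V (SymmetricPower.tprod ℂ v) = symmetrizer V (-1) v :=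
  (PiTensorProduct.lift.tprod v : PiTensorProduct.lift (symmetrizer V (-1)) _ = _)

lemma exists_isSkewModel_symSq [FiniteDimensional ℂ V] (hB : B.Nondegenerate)
    (hinv : ∀ g x y, B (ρ g x) (ρ g y) = B x y) (hsymm : ∀ x y, B x y = - B y x) :
    ∃ j, IsSkewModel ρ B (symSq ρ) j := by
  refine ⟨_, isSkewModel_of_tensor hB hinv (s := -1) (by norm_num)
    (fun x y => by rw [neg_one_mul, hsymm])
    (tensorOfMultilinear (SymmetricPower.tprod ℂ)) (symSqToTensor V)
    (fun y => ?_) (fun t => ?_) fun g t => ?_⟩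
  · refine LinearMap.congr_fun (f := tensorOfMultilinear _ ∘ₗ symSqToTensor V)
      (g := (2 : ℂ) • LinearMap.id) (symSq_hom_ext fun v => ?_) y
    simp only [LinearMap.comp_apply, symSqToTensor_tprod,
      symmetrizer_apply, map_sub, map_smul, tensorOfMultilinear_tmul]
    have h1 : ![v 0, v 1] = v := by ext i; fin_cases i <;> rfl
    have h2 : ![v 1, v 0] = fun i => v (Equiv.swap 0 1 i) := by ext i; fin_cases i <;> rfl
    rw [h1, h2, SymmetricPower.tprod_equiv]
    simp [two_smul]
  · induction t using TensorProduct.induction_on with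
    | zero => simp
    | add x y hx hy => simp only [map_add, hx, hy, smul_add]; abel
    | tmul x y =>
      rw [tensorOfMultilinear_tmul, symSqToTensor_tprod]
      rfl
  · induction t using TensorProduct.induction_on with
    | zero => simp
    | add x y hx hy => simp only [map_add, hx, hy]
    | tmul x y =>
      rw [TensorProduct.map_tmul, tensorOfMultilinear_tmul, tensorOfMultilinear_tmul]
      change _ = symSqMap (ρ g) _
      rw [symSqMap_tprod]
      congr 1
      ext i; fin_cases i <;> rfl

end Models

/-! ### Rings of integers and residue fields of algebraic extensions of the p-adic numbers. -/

section Residue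

variable (p : ℕ) [Fact p.Prime] (L : Type*) [Field L] [Algebra ℚ_[p] L]
  [Algebra.IsAlgebraic ℚ_[p] L]

/-- The ring of integers of an algebraic extension of `ℚ_p`. -/
abbrev integers : ValuationSubring L := (absVal p L).valuationSubring

/-- The residue field of an algebraic extension of `ℚ_p`. -/
abbrev residueField : Type _ := IsLocalRing.ResidueField (integers p L)

variable {p L}

lemma isUnit_integers_iff (x : integers p L) : IsUnit x ↔ absVal p L x = 1 := by
  have hx : absVal p L x ≤ 1 := x.2
  constructor
  · rintro ⟨u, rfl⟩
    have h1 : absVal p L (u : integers p L) * absVal p L (↑u⁻¹ : integers p L) = 1 := by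
      rw [← map_mul, ← MulMemClass.coe_mul, Units.mul_inv, OneMemClass.coe_one, map_one]
    have h2 : absVal p L (↑u⁻¹ : integers p L) ≤ 1 := (↑u⁻¹ : integers p L).2
    refine le_antisymm hx ?_
    rw [← h1]
    exact mul_le_of_le_one_right' h2
  · intro h
    have hx0 : (x : L) ≠ 0 := fun h0 => by rw [h0, map_zero] at h; exact zero_ne_one h
    refine IsUnit.of_mul_eq_one ⟨(x : L)⁻¹, ?_⟩ (Subtype.ext (mul_inv_cancel₀ hx0))
    rw [Valuation.mem_valuationSubring_iff, map_inv₀, h, inv_one]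

lemma residue_eq_zero_iff (x : integers p L) :
    IsLocalRing.residue (integers p L) x = 0 ↔ absVal p L x < 1 := by
  have hx : absVal p L x ≤ 1 := x.2
  rw [IsLocalRing.residue_eq_zero_iff, IsLocalRing.mem_maximalIdeal, mem_nonunits_iff,
    isUnit_integers_iff]
  exact ⟨fun h => lt_of_le_of_ne hx h, fun h => h.ne⟩

lemma residue_eq_iff (x y : integers p L) :
    IsLocalRing.residue (integers p L) x = IsLocalRing.residue (integers p L) y ↔
      absVal p L (x - y : L) < 1 := by
  rw [← sub_eq_zero, ← map_sub, residue_eq_zero_iff]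
  rfl

lemma absVal_algebraMap {L' : Type*} [Field L'] [Algebra ℚ_[p] L'] [Algebra.IsAlgebraic ℚ_[p] L']
    [Algebra L L'] [IsScalarTower ℚ_[p] L L'] (x : L) :
    absVal p L' (algebraMap L L' x) = absVal p L x := by
  ext
  exact (spectralNorm.eq_of_tower (K := ℚ_[p]) (L := L') x).symm

variable (p) in
/-- The map of residue fields induced by a field extension. -/
def residueFieldMap (L L' : Type*) [Field L] [Algebra ℚ_[p] L]
    [Algebra.IsAlgebraic ℚ_[p] L] [Field L'] [Algebra ℚ_[p] L'] [Algebra.IsAlgebraic ℚ_[p] L']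
    [Algebra L L'] [IsScalarTower ℚ_[p] L L'] : residueField p L →+* residueField p L' :=
  let f : integers p L →+* integers p L' :=
    ((algebraMap L L').comp (integers p L).subtype).codRestrict (integers p L') fun x => by
      rw [Valuation.mem_valuationSubring_iff]
      exact (absVal_algebraMap (x : L)).trans_le x.2
  have : IsLocalHom f := ⟨fun x hx => by
    rw [isUnit_integers_iff] at hx ⊢
    rw [← hx]
    exact (absVal_algebraMap (x : L)).symm⟩
  IsLocalRing.ResidueField.map f

section Finite

variable [FiniteDimensional ℚ_[p] L]

/-- The closed unit ball is compact, hence covered by finitely many open balls of radius one, and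
each of these lies in a single residue class. -/
instance finite_residueField : Finite (residueField p L) := by
  let := spectralNorm.normedField ℚ_[p] L
  let := spectralNorm.normedSpace ℚ_[p] L
  have : ProperSpace L := FiniteDimensional.proper ℚ_[p] L
  obtain ⟨t, ht, htf, hcov⟩ := (isCompact_closedBall (0 : L) 1).finite_cover_balls one_pos
  have hmem (y : L) : y ∈ Metric.closedBall (0 : L) 1 ↔ y ∈ integers p L := by
    rw [mem_closedBall_zero_iff, Valuation.mem_valuationSubring_iff, ← NNReal.coe_le_coe]
    rfl
  have := htf.to_subtype
  refine Finite.of_surjective (fun y : t => IsLocalRing.residue (integers p L)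
    ⟨y, (hmem _).1 (ht y.2)⟩) fun c => ?_
  obtain ⟨x, rfl⟩ := IsLocalRing.residue_surjective c
  have := hcov ((hmem x).2 x.2)
  simp only [Set.mem_iUnion] at this
  obtain ⟨y, hy, hxy⟩ := this
  refine ⟨⟨y, hy⟩, ?_⟩
  rw [residue_eq_iff, ← NNReal.coe_lt_coe, Valuation.map_sub_swap]
  exact (mem_ball_iff_norm.1 hxy)

/-- A subspace of a finite-dimensional space is closed, so the distance to it is attained. This
replaces a limit argument when unramified extensions are classified. -/
lemma exists_best_approximation (S : Submodule ℚ_[p] L) (x : L) :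
    ∃ y ∈ S, ∀ z ∈ S, absVal p L (x - y) ≤ absVal p L (x - z) := by
  let := spectralNorm.normedField ℚ_[p] L
  let := spectralNorm.normedSpace ℚ_[p] L
  have : ProperSpace L := FiniteDimensional.proper ℚ_[p] L
  obtain ⟨y, hy, hxy⟩ := (Submodule.closed_of_finiteDimensional S).exists_infDist_eq_dist
    ⟨0, S.zero_mem⟩ x
  refine ⟨y, hy, fun z hz => ?_⟩
  have := Metric.infDist_le_dist_of_mem (x := x) (show z ∈ (S : Set L) from hz)
  rw [hxy, dist_eq_norm, dist_eq_norm] at this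
  exact NNReal.coe_le_coe.1 this

lemma absVal_pow_card_sub_one (x : L) (hx : absVal p L x = 1) :
    absVal p L (x ^ (Nat.card (residueField p L) - 1) - 1) < 1 := by
  have := Fintype.ofFinite (residueField p L)
  let y : integers p L := ⟨x, hx.le⟩
  have hy : IsLocalRing.residue (integers p L) y ≠ 0 := fun h => by
    rw [residue_eq_zero_iff] at h
    exact h.ne hx
  have h1 := FiniteField.pow_card_sub_one_eq_one _ hy
  rw [← map_pow, ← map_one (IsLocalRing.residue (integers p L)), residue_eq_iff,
    ← Nat.card_eq_fintype_card] at h1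
  exact h1

end Finite

end Residue

/-! ### Roots of unity of order `q ^ n - 1` as rigid representatives of residue classes. -/

section Base

variable (p : ℕ) [Fact p.Prime] (F : Type*) [Field F] [Algebra ℚ_[p] F] [FiniteDimensional ℚ_[p] F]

lemma one_lt_residueCard : 1 < residueCard p F :=
  Finite.one_lt_card_iff_nontrivial.2 (inferInstance : Nontrivial (residueField p F))

lemma exists_card_residueField_eq_pow (L : Type*) [Field L] [Algebra ℚ_[p] L]
    [FiniteDimensional ℚ_[p] L] [Algebra F L] [IsScalarTower ℚ_[p] F L] :
    ∃ f, 0 < f ∧ Nat.card (residueField p L) = residueCard p F ^ f := by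
  let := (residueFieldMap p F L).toAlgebra
  have := Fintype.ofFinite (residueField p F)
  have := Fintype.ofFinite (residueField p L)
  refine ⟨Module.finrank (residueField p F) (residueField p L), Module.finrank_pos, ?_⟩
  rw [residueCard, Nat.card_eq_fintype_card, Nat.card_eq_fintype_card]
  exact Module.card_eq_pow_finrank

lemma absVal_residueCard_lt :
    absVal p (AlgebraicClosure F) (residueCard p F : AlgebraicClosure F) < 1 := by
  have := Fintype.ofFinite (residueField p F)
  have h1 : ((residueCard p F : integers p F) : F) = (residueCard p F : F) := rfl
  have h2 : IsLocalRing.residue (integers p F) (residueCard p F : integers p F) = 0 := by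
    rw [map_natCast, residueCard, Nat.card_eq_fintype_card]
    exact Nat.cast_card_eq_zero (R := residueField p F)
  rw [residue_eq_zero_iff, h1, ← absVal_algebraMap (L' := (AlgebraicClosure F)), map_natCast] at h2
  exact h2

variable {F}

lemma absVal_eq_one_of_pow_eq_one {L : Type*} [Field L] (v : Valuation L ℝ≥0) {x : L} {m : ℕ}
    (hm : m ≠ 0) (hx : x ^ m = 1) : v x = 1 := by
  have := congrArg v hx
  rw [map_pow, map_one] at this
  exact (pow_eq_one_iff_of_nonneg zero_le hm).1 this

lemma absVal_residueCard_pow_sub_one {n : ℕ} (hn : 0 < n) :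
    absVal p (AlgebraicClosure F) ((residueCard p F ^ n - 1 : ℕ) : AlgebraicClosure F) = 1 := by
  have hq := one_lt_residueCard p F
  rw [Nat.cast_sub (Nat.one_le_pow _ _ (by omega)), Valuation.map_sub_swap]
  have h : absVal p (AlgebraicClosure F) ((residueCard p F ^ n : ℕ) : AlgebraicClosure F) < 1 := by
    rw [Nat.cast_pow, map_pow]
    exact pow_lt_one₀ zero_le (absVal_residueCard_lt p F) hn.ne'
  rw [Nat.cast_one, Valuation.map_one_sub_of_lt _ h]

lemma residueCard_pow_sub_one_ne_zero {n : ℕ} (hn : 0 < n) : residueCard p F ^ n - 1 ≠ 0 := by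
  have := Nat.one_lt_pow hn.ne' (one_lt_residueCard p F)
  omega

/-- If `u = x / y` is not `1`, its powers up to exponent `m - 1` sum to `0`. As `u` reduces to `1`,
this sum is also congruent to `m = q ^ n - 1`, which is a unit. -/
lemma eq_of_absVal_sub_lt {n : ℕ} (hn : 0 < n) {x y : AlgebraicClosure F}
    (hx : x ^ (residueCard p F ^ n - 1) = 1)
    (hy : y ^ (residueCard p F ^ n - 1) = 1) (h : absVal p (AlgebraicClosure F) (x - y) < 1) :
    x = y := by
  set m := residueCard p F ^ n - 1 with hm
  have hm0 : m ≠ 0 := residueCard_pow_sub_one_ne_zero p hn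
  have hvy := absVal_eq_one_of_pow_eq_one (absVal p (AlgebraicClosure F)) hm0 hy
  have hy0 : y ≠ 0 := fun h0 => by rw [h0, map_zero] at hvy; exact zero_ne_one hvy
  set u := x / y with hu
  have hum : u ^ m = 1 := by rw [hu, div_pow, hx, hy, div_one]
  have hu1 : absVal p (AlgebraicClosure F) (u - 1) < 1 := by
    have : u - 1 = (x - y) / y := by rw [hu]; field_simp
    rwa [this, map_div₀, hvy, div_one]
  have hvu := absVal_eq_one_of_pow_eq_one (absVal p (AlgebraicClosure F)) hm0 hum
  by_contra hne
  have hu_ne : u ≠ 1 := fun h1 => hne ((div_eq_one_iff_eq hy0).1 h1)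
  have hsum : ∑ k ∈ Finset.range m, u ^ k = 0 := by
    have := geom_sum_mul u m
    rw [hum, sub_self] at this
    exact (mul_eq_zero.1 this).resolve_right (sub_ne_zero.2 hu_ne)
  have h1 : absVal p (AlgebraicClosure F) (∑ k ∈ Finset.range m, (u ^ k - 1)) < 1 := by
    refine Valuation.map_sum_lt _ one_ne_zero fun k _ => ?_
    have := pow_sub_pow_lt (absVal p (AlgebraicClosure F)) hvu.le (map_one _).le hu1 k
    rwa [one_pow] at this
  rw [Finset.sum_sub_distrib, hsum, zero_sub, Valuation.map_neg] at h1
  simp only [Finset.sum_const, Finset.card_range, nsmul_eq_mul, mul_one] at h1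
  exact h1.ne (absVal_residueCard_pow_sub_one p hn)

lemma exists_isPrimitiveRoot {n : ℕ} (hn : 0 < n) :
    ∃ ζ : AlgebraicClosure F, IsPrimitiveRoot ζ (residueCard p F ^ n - 1) := by
  have : NeZero ((residueCard p F ^ n - 1 : ℕ) : AlgebraicClosure F) := ⟨fun h => by
    have h1 := absVal_residueCard_pow_sub_one p (F := F) hn
    rw [h, map_zero] at h1
    exact zero_ne_one h1⟩
  exact HasEnoughRootsOfUnity.exists_primitiveRoot (AlgebraicClosure F) _

/-- A substitute for Hensel's lemma: `x ^ m - 1` is the product of the factors `x - ζ`, so some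
factor has absolute value below one. -/
lemma exists_rootOfUnity_near {n : ℕ} (hn : 0 < n) {x : AlgebraicClosure F}
    (hx : absVal p (AlgebraicClosure F) (x ^ (residueCard p F ^ n - 1) - 1) < 1) :
    ∃ ζ : AlgebraicClosure F, ζ ^ (residueCard p F ^ n - 1) = 1 ∧
      absVal p (AlgebraicClosure F) (x - ζ) < 1 := by
  obtain ⟨ζ, hζ⟩ := exists_isPrimitiveRoot p (F := F) hn
  have hm := Nat.pos_of_ne_zero (residueCard_pow_sub_one_ne_zero p (F := F) hn)
  have h1 := hζ.pow_sub_pow_eq_prod_sub_mul x 1 hm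
  rw [one_pow] at h1
  rw [h1, map_prod] at hx
  by_contra! hcon
  refine absurd hx (not_lt.2 (Finset.one_le_prod' fun ξ hξ => ?_))
  rw [mul_one]
  exact hcon ξ ((Polynomial.mem_nthRootsFinset hm _).1 hξ)

end Base

/-! ### The Galois action on these roots of unity. -/

section Frobenius

variable (p : ℕ) [Fact p.Prime] (F : Type*) [Field F] [Algebra ℚ_[p] F] [FiniteDimensional ℚ_[p] F]

lemma exists_residueFrobenius :
    ∃ φ : residueField p (AlgebraicClosure F) →+* residueField p (AlgebraicClosure F), ∀ c, φ c =
      c ^ (residueCard p F) := by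
  have := Fintype.ofFinite (residueField p F)
  obtain ⟨r, hr⟩ := CharP.exists (residueField p F)
  obtain ⟨f, hrp, hf⟩ := FiniteField.card (residueField p F) r
  have : Fact r.Prime := ⟨hrp⟩
  have := charP_of_injective_ringHom (residueFieldMap p F (AlgebraicClosure F)).injective r
  refine ⟨iterateFrobenius _ r f, fun c => ?_⟩
  rw [iterateFrobenius_def, residueCard, Nat.card_eq_fintype_card, hf]

/-- The Frobenius endomorphism `c ↦ c ^ (residueCard p F)` of the residue field of the algebraic
closure. -/
def residueFrobenius : residueField p (AlgebraicClosure F) →+* residueField p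
    (AlgebraicClosure F) :=
  (exists_residueFrobenius p F).choose

lemma residueFrobenius_apply (c : residueField p (AlgebraicClosure F)) :
    residueFrobenius p F c = c ^ (residueCard p F) :=
  (exists_residueFrobenius p F).choose_spec c

variable {F}

/-- The polynomial `X ^ Q - X` has at most `Q` roots, and the residue field of `L` already supplies
`Q` of them. -/
lemma exists_residueFieldMap_eq (L : Type*) [Field L] [Algebra ℚ_[p] L]
    [FiniteDimensional ℚ_[p] L] [Algebra L (AlgebraicClosure F)]
    [IsScalarTower ℚ_[p] L (AlgebraicClosure F)] {c : residueField p (AlgebraicClosure F)}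
    (hc : c ^ Nat.card (residueField p L) = c) :
    ∃ y, residueFieldMap p L (AlgebraicClosure F) y = c := by
  have := Fintype.ofFinite (residueField p L)
  rw [Nat.card_eq_fintype_card] at hc
  by_contra! hcon
  classical
  have hQ : 1 < Fintype.card (residueField p L) := Fintype.one_lt_card
  have h1 := Polynomial.card_le_degree_of_subset_roots
    (p := (Polynomial.X ^ Fintype.card (residueField p L) - Polynomial.X :
      Polynomial (residueField p (AlgebraicClosure F))))
    (Z := insert c (Finset.univ.image (residueFieldMap p L (AlgebraicClosure F)))) fun x hx => by
      rw [Polynomial.mem_roots (FiniteField.X_pow_card_sub_X_ne_zero _ hQ), Polynomial.IsRoot,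
        Polynomial.eval_sub, Polynomial.eval_pow, Polynomial.eval_X, sub_eq_zero]
      rcases Finset.mem_insert.1 hx with rfl | hx
      · exact hc
      · obtain ⟨y, -, rfl⟩ := Finset.mem_image.1 hx
        rw [← map_pow, FiniteField.pow_card]
  rw [FiniteField.X_pow_card_sub_X_natDegree_eq _ hQ, Finset.card_insert_of_notMem
    (by simpa using hcon),
    Finset.card_image_of_injective _ (residueFieldMap p L (AlgebraicClosure F)).injective,
      Finset.card_univ] at h1
  omega

lemma residueFieldMap_pow (y : residueField p F) :
    residueFieldMap p F (AlgebraicClosure F) y ^ (residueCard p F) =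
      residueFieldMap p F (AlgebraicClosure F) y := by
  have := Fintype.ofFinite (residueField p F)
  rw [← map_pow, residueCard, Nat.card_eq_fintype_card, FiniteField.pow_card]

/-- The endomorphism of the residue field induced by an automorphism. -/
def residueAut (w : AbsGal F) : residueField p (AlgebraicClosure F) →+*
    residueField p (AlgebraicClosure F) :=
  let f : integers p (AlgebraicClosure F) →+* integers p (AlgebraicClosure F) :=
    ((w : AlgebraicClosure F →+* (AlgebraicClosure F)).comp (integers p
      (AlgebraicClosure F)).subtype).codRestrict (integers p (AlgebraicClosure F)) fun x => by
      rw [Valuation.mem_valuationSubring_iff]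
      exact (absVal_apply_aut p w (x : AlgebraicClosure F)).trans_le x.2
  have : IsLocalHom f := ⟨fun x hx => by
    rw [isUnit_integers_iff] at hx ⊢
    rw [← hx]
    exact (absVal_apply_aut p w (x : AlgebraicClosure F)).symm⟩
  IsLocalRing.ResidueField.map f

lemma residueAut_residue (w : AbsGal F) (x : integers p (AlgebraicClosure F))
    (hx : w x ∈ integers p (AlgebraicClosure F)) :
    residueAut p w (IsLocalRing.residue _ x) = IsLocalRing.residue (integers p
      (AlgebraicClosure F)) ⟨w x, hx⟩ := rfl

lemma residueAut_residueFieldMap (w : AbsGal F) (y : residueField p F) :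
    residueAut p w (residueFieldMap p F (AlgebraicClosure F) y) =
      residueFieldMap p F (AlgebraicClosure F) y := by
  obtain ⟨x, rfl⟩ := IsLocalRing.residue_surjective y
  refine congrArg (IsLocalRing.residue (integers p (AlgebraicClosure F))) (Subtype.ext ?_)
  exact w.commutes (x : F)

lemma mem_integers_of_pow_eq_one {x : AlgebraicClosure F} {m : ℕ} (hm : m ≠ 0) (hx : x ^ m = 1) :
    x ∈ integers p (AlgebraicClosure F) :=
  (absVal_eq_one_of_pow_eq_one (absVal p (AlgebraicClosure F)) hm hx).le

/-- Frobenius permutes the residue classes `c ^ q ^ i` cyclically, so the polynomial with these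
roots has coefficients in the residue field of `F`. Hence `w` permutes its roots, and rigidity lifts
the conclusion to roots of unity. -/
lemma aut_rootOfUnity {n : ℕ} (hn : 0 < n) {ζ : AlgebraicClosure F}
    (hζ : ζ ^ (residueCard p F ^ n - 1) = 1) (w : AbsGal F) :
    ∃ i < n, w ζ = ζ ^ residueCard p F ^ i := by
  have hm := residueCard_pow_sub_one_ne_zero p (F := F) hn
  let z : integers p (AlgebraicClosure F) := ⟨ζ, mem_integers_of_pow_eq_one p hm hζ⟩
  let c := IsLocalRing.residue (integers p (AlgebraicClosure F)) z
  have hcn : c ^ residueCard p F ^ n = c := by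
    have h1 : z ^ (residueCard p F ^ n - 1) = 1 := Subtype.ext hζ
    have h2 : c ^ (residueCard p F ^ n - 1) = 1 := by rw [← map_pow, h1, map_one]
    have h3 : residueCard p F ^ n = residueCard p F ^ n - 1 + 1 := by omega
    rw [h3, pow_succ, h2, one_mul]
  let h : Polynomial (residueField p (AlgebraicClosure F)) :=
    ∏ i ∈ Finset.range n, (Polynomial.X - Polynomial.C (c ^ residueCard p F ^ i))
  have hφ : h.map (residueFrobenius p F) = h := by
    simp only [h, Polynomial.map_prod, Polynomial.map_sub, Polynomial.map_X, Polynomial.map_C,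
      residueFrobenius_apply, ← pow_mul, ← pow_succ]
    have h1 := Finset.prod_range_succ
      (fun i => Polynomial.X - Polynomial.C (c ^ residueCard p F ^ i)) n
    rw [Finset.prod_range_succ', hcn, pow_zero, pow_one] at h1
    exact mul_right_cancel₀ (Polynomial.X_sub_C_ne_zero c) h1
  have hw : h.map (residueAut p w) = h := by
    ext i
    rw [Polynomial.coeff_map]
    have h1 : h.coeff i ^ (residueCard p F) = h.coeff i := by
      rw [← residueFrobenius_apply, ← Polynomial.coeff_map, hφ]
    obtain ⟨y, hy⟩ := exists_residueFieldMap_eq p F h1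
    rw [← hy, residueAut_residueFieldMap]
  have hroot : h.eval c = 0 := by
    rw [Polynomial.eval_prod]
    exact Finset.prod_eq_zero (Finset.mem_range.2 hn) (by simp)
  have hwm : (w ζ) ^ (residueCard p F ^ n - 1) = 1 := by rw [← map_pow, hζ, map_one]
  have hwz := mem_integers_of_pow_eq_one p hm hwm
  have hroot' : h.eval (residueAut p w c) = 0 := by
    rw [← hw, Polynomial.eval_map_apply, hroot, map_zero]
  rw [Polynomial.eval_prod, Finset.prod_eq_zero_iff] at hroot'
  obtain ⟨i, hi, h2⟩ := hroot'
  refine ⟨i, Finset.mem_range.1 hi, eq_of_absVal_sub_lt p hn hwm ?_ ?_⟩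
  · rw [← pow_mul, mul_comm, pow_mul, hζ, one_pow]
  · rw [Polynomial.eval_sub, Polynomial.eval_X, Polynomial.eval_C, sub_eq_zero,
      residueAut_residue p w z hwz, ← map_pow, residue_eq_iff] at h2
    exact h2

/-- A polynomial over the residue field is defined over the residue field of `F` if it lifts to a
polynomial over `F`; its roots are then stable under `c ↦ c ^ (residueCard p F)`. -/
lemma eval_pow_residueCard_eq_zero {R : Polynomial (integers p (AlgebraicClosure F))}
    (hR : ∀ i, ∃ y : F, algebraMap F (AlgebraicClosure F) y = R.coeff i)
    {c : residueField p (AlgebraicClosure F)}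
    (hc : (R.map (IsLocalRing.residue _)).eval c = 0) :
    (R.map (IsLocalRing.residue _)).eval (c ^ (residueCard p F)) = 0 := by
  have h : (R.map (IsLocalRing.residue _)).map (residueFrobenius p F) =
      R.map (IsLocalRing.residue _) := by
    ext i
    rw [Polynomial.coeff_map, Polynomial.coeff_map, residueFrobenius_apply]
    obtain ⟨y, hy⟩ := hR i
    have hy1 : y ∈ integers p F := by
      have h1 : absVal p (AlgebraicClosure F) (R.coeff i) ≤ 1 := (R.coeff i).2
      rw [← hy, absVal_algebraMap] at h1
      exact h1
    have h2 : IsLocalRing.residue (integers p (AlgebraicClosure F)) (R.coeff i) =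
        residueFieldMap p F (AlgebraicClosure F) (IsLocalRing.residue (integers p F) ⟨y, hy1⟩) :=
      congrArg (IsLocalRing.residue (integers p (AlgebraicClosure F))) (Subtype.ext hy.symm)
    rw [h2, residueFieldMap_pow]
  rw [← h, ← residueFrobenius_apply, Polynomial.eval_map_apply, hc, map_zero]

/-- The roots of the minimal polynomial of `ζ` are roots of unity, so it reduces modulo the maximal
ideal, and the roots of the reduction are stable under Frobenius. Therefore `ζ ^ q` is congruent to
a conjugate of `ζ`, and by rigidity equal to it. -/
lemma exists_aut_rootOfUnity {n : ℕ} (hn : 0 < n) {ζ : AlgebraicClosure F}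
    (hζ : ζ ^ (residueCard p F ^ n - 1) = 1) :
    ∃ g : AbsGal F, g ζ = ζ ^ (residueCard p F) := by
  have hm := residueCard_pow_sub_one_ne_zero p (F := F) hn
  have hint : IsIntegral F ζ := Algebra.IsIntegral.isIntegral ζ
  let P := (minpoly F ζ).map (algebraMap F (AlgebraicClosure F))
  have hsplit : P.Splits := IsAlgClosed.splits _
  have hP : P = (P.roots.map fun ξ => Polynomial.X - Polynomial.C ξ).prod :=
    hsplit.eq_prod_roots_of_monic ((minpoly.monic hint).map _)
  have hPdvd : P ∣ Polynomial.X ^ (residueCard p F ^ n - 1) - 1 := by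
    have h1 : minpoly F ζ ∣ Polynomial.X ^ (residueCard p F ^ n - 1) - 1 :=
      minpoly.dvd _ _ (by simp [hζ])
    simpa using Polynomial.map_dvd (algebraMap F (AlgebraicClosure F)) h1
  have hroots : ∀ ξ ∈ P.roots, ξ ^ (residueCard p F ^ n - 1) = 1 := fun ξ hξ => by
    have h1 := Polynomial.IsRoot.dvd (Polynomial.isRoot_of_mem_roots hξ) hPdvd
    simpa [sub_eq_zero] using h1
  have hlift : P ∈ Polynomial.lifts (integers p (AlgebraicClosure F)).subtype := by
    rw [hP]
    refine Subsemiring.multiset_prod_mem _ _ fun f hf => ?_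
    obtain ⟨ξ, hξ, rfl⟩ := Multiset.mem_map.1 hf
    rw [Polynomial.mem_lifts]
    exact ⟨Polynomial.X - Polynomial.C ⟨ξ, mem_integers_of_pow_eq_one p hm (hroots ξ hξ)⟩,
      by simp⟩
  obtain ⟨R, hR⟩ := (Polynomial.mem_lifts _).1 hlift
  have hRF (i) : ∃ y : F, algebraMap F (AlgebraicClosure F) y = R.coeff i := by
    refine ⟨(minpoly F ζ).coeff i, ?_⟩
    rw [← Polynomial.coeff_map]
    change P.coeff i = _
    rw [← hR, Polynomial.coeff_map]
    rfl
  let z : integers p (AlgebraicClosure F) := ⟨ζ, mem_integers_of_pow_eq_one p hm hζ⟩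
  have hev (x : integers p (AlgebraicClosure F)) : ((R.eval x : integers p (AlgebraicClosure F)) :
    AlgebraicClosure F) = P.eval (x : AlgebraicClosure F) := by
    rw [← hR]
    exact (Polynomial.eval_map_apply (integers p (AlgebraicClosure F)).subtype x).symm
  have hz : R.eval z = 0 := Subtype.ext (by
    rw [hev, Polynomial.eval_map_algebraMap]; exact minpoly.aeval F ζ)
  have h1 := eval_pow_residueCard_eq_zero p hRF
    (c := IsLocalRing.residue _ z) (by rw [Polynomial.eval_map_apply, hz, map_zero])
  rw [← map_pow, Polynomial.eval_map_apply, residue_eq_zero_iff, hev,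
    hsplit.eval_eq_prod_roots_of_monic ((minpoly.monic hint).map _), map_multiset_prod,
    Multiset.map_map] at h1
  obtain ⟨ξ, hξ, hlt⟩ : ∃ ξ ∈ P.roots, absVal p (AlgebraicClosure F) (ζ ^ (residueCard p F) - ξ) <
    1 := by
    by_contra! hcon
    refine absurd h1 (not_lt.2 (Multiset.one_le_prod fun x hx => ?_))
    obtain ⟨ξ, hξ, rfl⟩ := Multiset.mem_map.1 hx
    exact hcon ξ hξ
  have hξ' : ζ ^ (residueCard p F) = ξ := eq_of_absVal_sub_lt p hn
    (by rw [← pow_mul, mul_comm, pow_mul, hζ, one_pow]) (hroots ξ hξ) hlt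
  have hroot := Polynomial.isRoot_of_mem_roots hξ
  rw [← hξ', Polynomial.IsRoot, Polynomial.eval_map_algebraMap] at hroot
  exact minpoly.exists_algEquiv_of_root' (Algebra.IsAlgebraic.isAlgebraic _) hroot

end Frobenius

/-! ### Existence of a Frobenius element and its powers. -/

section FrobeniusExists

variable (p : ℕ) [Fact p.Prime] {F : Type*} [Field F] [Algebra ℚ_[p] F] [FiniteDimensional ℚ_[p] F]

lemma pow_residueCard_pow_sub_one_eq_one_of_dvd {M : Type*} [Monoid M] {m n : ℕ} (h : m ∣ n) {x : M}
    (hx : x ^ (residueCard p F ^ m - 1) = 1) : x ^ (residueCard p F ^ n - 1) = 1 := by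
  obtain ⟨k, hk⟩ : residueCard p F ^ m - 1 ∣ residueCard p F ^ n - 1 := by
    obtain ⟨k, rfl⟩ := h
    rw [pow_mul]
    exact Nat.sub_one_dvd_pow_sub_one _ _
  rw [hk, pow_mul, hx, one_pow]

lemma finiteDimensional_intermediateField (L : IntermediateField F (AlgebraicClosure F))
    [FiniteDimensional F L] : FiniteDimensional ℚ_[p] L :=
  FiniteDimensional.trans ℚ_[p] F L

instance isScalarTower_intermediateField (L : IntermediateField F (AlgebraicClosure F)) :
    IsScalarTower ℚ_[p] L (AlgebraicClosure F) :=
  IsScalarTower.of_algebraMap_eq fun x => by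
    rw [IsScalarTower.algebraMap_apply ℚ_[p] F L, ← IsScalarTower.algebraMap_apply F L,
      ← IsScalarTower.algebraMap_apply]

lemma isGalois_algebraicClosure (p : ℕ) [Fact p.Prime] (F : Type*) [Field F] [Algebra ℚ_[p] F] :
    IsGalois F (AlgebraicClosure F) := by
  have : CharZero F := charZero_of_injective_algebraMap (algebraMap ℚ_[p] F).injective
  infer_instance

lemma exists_rootOfUnity_near_of_absVal_eq_one {x : AlgebraicClosure F}
    (hx : absVal p (AlgebraicClosure F) x = 1) :
    ∃ n, 0 < n ∧ ∃ ζ : AlgebraicClosure F, ζ ^ (residueCard p F ^ n - 1) = 1 ∧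
      absVal p (AlgebraicClosure F) (x - ζ) < 1 := by
  let L := IntermediateField.adjoin F {x}
  have : FiniteDimensional F L :=
    IntermediateField.adjoin.finiteDimensional (Algebra.IsIntegral.isIntegral x)
  have := finiteDimensional_intermediateField p L
  let y : L := ⟨x, IntermediateField.mem_adjoin_simple_self F x⟩
  obtain ⟨n, hn, hcard⟩ := exists_card_residueField_eq_pow p F L
  have h1 := absVal_pow_card_sub_one (p := p) y
    (by rw [← absVal_algebraMap (L' := AlgebraicClosure F)]; exact hx)
  rw [hcard, ← absVal_algebraMap (L' := AlgebraicClosure F), map_sub, map_pow, map_one] at h1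
  exact ⟨n, hn, exists_rootOfUnity_near p hn h1⟩

/-- Each nonzero residue class contains a root of unity of order dividing some `q ^ n - 1`, and
congruent roots of this kind are equal. -/
lemma actsAsFrobPow_iff {g : AbsGal F} {k : ℕ} :
    ActsAsFrobPow p g k ↔ ∀ n, 0 < n → ∀ ζ : AlgebraicClosure F,
      ζ ^ (residueCard p F ^ n - 1) = 1 → g ζ = ζ ^ residueCard p F ^ k := by
  have hq := one_lt_residueCard p F
  constructor
  · intro h n hn ζ hζ
    refine eq_of_absVal_sub_lt p hn (by rw [← map_pow, hζ, map_one])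
      (by rw [← pow_mul, mul_comm, pow_mul, hζ, one_pow]) (h ζ ?_)
    exact mem_integers_of_pow_eq_one p (residueCard_pow_sub_one_ne_zero p hn) hζ
  · intro h x hx
    rcases hx.lt_or_eq with hx1 | hx1
    · refine Valuation.map_sub_lt _ (by rwa [absVal_apply_aut]) ?_
      rw [map_pow]
      exact pow_lt_one₀ zero_le hx1 (pow_pos (by omega) _).ne'
    · obtain ⟨n, hn, ζ, hζ, hxζ⟩ := exists_rootOfUnity_near_of_absVal_eq_one p hx1
      have hvζ := mem_integers_of_pow_eq_one p (residueCard_pow_sub_one_ne_zero p hn) hζ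
      have h1 : absVal p (AlgebraicClosure F) (g x - g ζ) < 1 := by
        rwa [← map_sub, absVal_apply_aut]
      have h2 := pow_sub_pow_lt _ hx hvζ hxζ (residueCard p F ^ k)
      rw [Valuation.map_sub_swap, ← h n hn ζ hζ] at h2
      have := Valuation.map_add_lt _ h1 h2
      rwa [sub_add_sub_cancel] at this

lemma actsAsFrobPow_zero_iff {g : AbsGal F} : ActsAsFrobPow p g 0 ↔ g ∈ inertia p F := by
  refine forall₂_congr fun x _ => ?_
  rw [pow_zero, pow_one]

variable {p} in
lemma ActsAsFrobPow.pow {g : AbsGal F} (hg : ActsAsFrobPow p g 1) (k : ℕ) :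
    ActsAsFrobPow p (g ^ k) k := by
  induction k with
  | zero => exact (actsAsFrobPow_zero_iff p).2 (one_mem _)
  | succ k ih =>
    rw [pow_succ, add_comm]
    exact ih.mul hg

variable {p} in
lemma ActsAsFrobPow.apply_rootOfUnity {g : AbsGal F} {k : ℕ} (hg : ActsAsFrobPow p g k) {n : ℕ}
    (hn : 0 < n) {ζ : AlgebraicClosure F} (hζ : ζ ^ (residueCard p F ^ n - 1) = 1) :
    g ζ = ζ ^ residueCard p F ^ k := (actsAsFrobPow_iff p).1 hg n hn ζ hζ

lemma isClosed_setOf_apply_eq [IsGalois F (AlgebraicClosure F)] (x y : AlgebraicClosure F) :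
    IsClosed {g : AbsGal F | g x = y} := by
  rcases Set.eq_empty_or_nonempty {g : AbsGal F | g x = y} with h | ⟨g, hg⟩
  · rw [h]
    exact isClosed_empty
  · have : {g : AbsGal F | g x = y} =
        (fun h => g⁻¹ * h) ⁻¹' (IntermediateField.adjoin F {x}).fixingSubgroup := by
      ext h
      have h1 : (g⁻¹ * h) ∈ (IntermediateField.adjoin F {x}).fixingSubgroup ↔
          (g⁻¹ * h) x = x := by
        rw [IntermediateField.mem_fixingSubgroup_iff]
        exact (IntermediateField.forall_mem_adjoin_smul_eq_self_iff F (g⁻¹ * h)).trans (by simp)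
      rw [Set.mem_preimage, SetLike.mem_coe, h1, Set.mem_ofPred_eq, AlgEquiv.mul_apply]
      refine ⟨fun h2 => ?_, fun h2 => ?_⟩
      · rw [h2, ← hg, ← AlgEquiv.mul_apply, inv_mul_cancel, AlgEquiv.one_apply]
      · have h3 := congrArg g h2
        rw [← AlgEquiv.mul_apply, mul_inv_cancel, AlgEquiv.one_apply] at h3
        exact h3.trans hg
    rw [this]
    exact (InfiniteGalois.fixingSubgroup_isClosed _).preimage (continuous_const_mul _)

variable (F) in
-- The condition at each finite level defines a nonempty closed set, and the Galois group is
-- compact.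
lemma exists_actsAsFrobPow_one : ∃ g : AbsGal F, ActsAsFrobPow p g 1 := by
  have := isGalois_algebraicClosure p F
  -- Factorials form a divisibility chain in which every `n` eventually divides, so the sets are
  -- nested and cover all levels.
  let D (N : ℕ) : Set (AbsGal F) := {g | ∀ ζ : AlgebraicClosure F,
    ζ ^ (residueCard p F ^ (N + 1).factorial - 1) = 1 → g ζ = ζ ^ residueCard p F}
  have hclosed (N) : IsClosed (D N) := by
    simp only [D, Set.ofPred_forall]
    exact isClosed_iInter fun ζ => isClosed_iInter fun _ => isClosed_setOf_apply_eq _ _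
  have hne : (⋂ N, D N).Nonempty := by
    refine IsCompact.nonempty_iInter_of_sequence_nonempty_isCompact_isClosed D (fun N g hg ζ hζ =>
      ?_)
      (fun N => ?_) (hclosed 0).isCompact hclosed
    · exact hg ζ (pow_residueCard_pow_sub_one_eq_one_of_dvd p
        (Nat.factorial_dvd_factorial (Nat.le_succ _)) hζ)
    · have hN := Nat.factorial_pos (N + 1)
      obtain ⟨ζ, hζ⟩ := exists_isPrimitiveRoot p (F := F) hN
      obtain ⟨g, hg⟩ := exists_aut_rootOfUnity p hN hζ.pow_eq_one
      have := NeZero.mk (residueCard_pow_sub_one_ne_zero p (F := F) hN)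
      refine ⟨g, fun ξ hξ => ?_⟩
      obtain ⟨i, -, rfl⟩ := hζ.eq_pow_of_pow_eq_one hξ
      rw [map_pow, hg, ← pow_mul, ← pow_mul, mul_comm]
  obtain ⟨g, hg⟩ := hne
  refine ⟨g, (actsAsFrobPow_iff p).2 fun n hn ζ hζ => ?_⟩
  rw [pow_one]
  refine Set.mem_iInter.1 hg n ζ (pow_residueCard_pow_sub_one_eq_one_of_dvd p ?_ hζ)
  exact Nat.dvd_factorial hn (Nat.le_succ _)

/-- Rests on the gcd of `q ^ n - 1` and `q ^ k - 1` being `q ^ gcd n k - 1`. -/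
lemma rootOfUnity_pow_residueCard_pow_eq_iff {n : ℕ} {ζ : AlgebraicClosure F} (hn : 0 < n)
    (hζ : IsPrimitiveRoot ζ (residueCard p F ^ n - 1)) {k : ℕ} :
    ζ ^ residueCard p F ^ k = ζ ↔ n ∣ k := by
  have hq := one_lt_residueCard p F
  have hpos : 0 < residueCard p F ^ k := pow_pos (by omega) _
  have h0 : ζ ≠ 0 := hζ.ne_zero (residueCard_pow_sub_one_ne_zero p hn)
  have h1 : ζ ^ residueCard p F ^ k = ζ ↔ ζ ^ (residueCard p F ^ k - 1) = 1 := by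
    conv_lhs => rw [← Nat.sub_add_cancel hpos, pow_succ]
    rw [mul_eq_right₀ h0]
  rw [h1]
  refine ⟨fun h => ?_, fun h => pow_residueCard_pow_sub_one_eq_one_of_dvd p h hζ.pow_eq_one⟩
  have h2 := Nat.gcd_eq_left (hζ.dvd_of_pow_eq_one _ h)
  rw [Nat.pow_sub_one_gcd_pow_sub_one] at h2
  have h3 : residueCard p F ^ n.gcd k = residueCard p F ^ n := by
    have := Nat.one_le_pow (n.gcd k) _ (zero_lt_one.trans hq)
    have := Nat.one_le_pow n _ (zero_lt_one.trans hq)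
    omega
  rw [← Nat.pow_right_injective hq h3]
  exact Nat.gcd_dvd_right _ _

end FrobeniusExists

/-! ### Classification of the finite unramified extensions. -/

section UnramifiedExt

variable (p : ℕ) [Fact p.Prime] (F : Type*) [Field F] [Algebra ℚ_[p] F] [FiniteDimensional ℚ_[p] F]

/-- The unramified extension of degree `n` of `F`, generated by the roots of unity of order dividing
`q ^ n - 1`. -/
def unramifiedExt (n : ℕ) : IntermediateField F (AlgebraicClosure F) :=
  IntermediateField.adjoin F {ζ | ζ ^ (residueCard p F ^ n - 1) = 1}

variable {F}

lemma mem_unramifiedExt {n : ℕ} {ζ : AlgebraicClosure F}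
    (hζ : ζ ^ (residueCard p F ^ n - 1) = 1) : ζ ∈ unramifiedExt p F n :=
  IntermediateField.subset_adjoin F _ hζ

lemma unramifiedExt_mono {m n : ℕ} (h : m ∣ n) : unramifiedExt p F m ≤ unramifiedExt p F n :=
  IntermediateField.adjoin.mono F _ _ fun _ hζ =>
    pow_residueCard_pow_sub_one_eq_one_of_dvd p h hζ

lemma unramifiedExt_eq_adjoin {n : ℕ} (hn : 0 < n) {ζ : AlgebraicClosure F}
    (hζ : IsPrimitiveRoot ζ (residueCard p F ^ n - 1)) :
    unramifiedExt p F n = IntermediateField.adjoin F {ζ} := by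
  have := NeZero.mk (residueCard_pow_sub_one_ne_zero p (F := F) hn)
  refine le_antisymm (IntermediateField.adjoin_le_iff.2 fun ξ hξ => ?_)
    (IntermediateField.adjoin_simple_le_iff.2 (mem_unramifiedExt p hζ.pow_eq_one))
  obtain ⟨i, -, rfl⟩ := hζ.eq_pow_of_pow_eq_one hξ
  exact pow_mem (IntermediateField.mem_adjoin_simple_self F ζ) i

lemma mem_fixingSubgroup_unramifiedExt_iff {n : ℕ} (hn : 0 < n) {ζ : AlgebraicClosure F}
    (hζ : IsPrimitiveRoot ζ (residueCard p F ^ n - 1)) (g : AbsGal F) :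
    g ∈ (unramifiedExt p F n).fixingSubgroup ↔ g ζ = ζ := by
  rw [unramifiedExt_eq_adjoin p hn hζ, IntermediateField.mem_fixingSubgroup_iff]
  exact (IntermediateField.forall_mem_adjoin_smul_eq_self_iff F g).trans (by simp)

lemma finiteDimensional_unramifiedExt {n : ℕ} (hn : 0 < n) :
    FiniteDimensional F (unramifiedExt p F n) := by
  obtain ⟨ζ, hζ⟩ := exists_isPrimitiveRoot p (F := F) hn
  rw [unramifiedExt_eq_adjoin p hn hζ]
  exact IntermediateField.adjoin.finiteDimensional (Algebra.IsIntegral.isIntegral ζ)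

lemma rootOfUnity_pow_residueCard_pow_injOn {n : ℕ} (hn : 0 < n) {ζ : AlgebraicClosure F}
    (hζ : IsPrimitiveRoot ζ (residueCard p F ^ n - 1)) :
    Set.InjOn (fun i => ζ ^ residueCard p F ^ i) (Finset.range n) := by
  obtain ⟨φ, hφ⟩ := exists_actsAsFrobPow_one p F
  have key {i j : ℕ} (hij : i ≤ j) (hj : j < n)
      (h : ζ ^ residueCard p F ^ i = ζ ^ residueCard p F ^ j) : i = j := by
    have h1 : ζ ^ residueCard p F ^ (j - i) = ζ := by
      apply (φ ^ i).injective
      rw [map_pow, (hφ.pow i).apply_rootOfUnity hn hζ.pow_eq_one, ← pow_mul, ← pow_add,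
        Nat.add_sub_cancel' hij, h]
    have := Nat.eq_zero_of_dvd_of_lt ((rootOfUnity_pow_residueCard_pow_eq_iff p hn hζ).1 h1)
      (by omega)
    omega
  intro i hi j hj h
  have hi := Finset.mem_range.1 hi
  have hj := Finset.mem_range.1 hj
  rcases le_total i j with hij | hij
  · exact key hij hj h
  · exact (key hij hi h.symm).symm

/-- The conjugates of `ζ` are exactly the `n` distinct powers `ζ ^ q ^ i` with `i < n`. -/
lemma natDegree_minpoly_rootOfUnity {n : ℕ} (hn : 0 < n) {ζ : AlgebraicClosure F}
    (hζ : IsPrimitiveRoot ζ (residueCard p F ^ n - 1)) : (minpoly F ζ).natDegree = n := by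
  classical
  have := isGalois_algebraicClosure p F
  obtain ⟨φ, hφ⟩ := exists_actsAsFrobPow_one p F
  have hint : IsIntegral F ζ := Algebra.IsIntegral.isIntegral ζ
  have hset : (minpoly F ζ).rootSet (AlgebraicClosure F) =
      ((Finset.range n).image fun i => ζ ^ residueCard p F ^ i : Finset (AlgebraicClosure F)) := by
    ext x
    rw [Polynomial.mem_rootSet_of_ne (minpoly.ne_zero hint), Finset.mem_coe, Finset.mem_image]
    constructor
    · intro hx
      obtain ⟨g, rfl⟩ := minpoly.exists_algEquiv_of_root' (Algebra.IsAlgebraic.isAlgebraic _) hx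
      obtain ⟨i, hi, h⟩ := aut_rootOfUnity p hn hζ.pow_eq_one g
      exact ⟨i, Finset.mem_range.2 hi, h.symm⟩
    · rintro ⟨i, -, rfl⟩
      rw [← (hφ.pow i).apply_rootOfUnity hn hζ.pow_eq_one, Polynomial.aeval_algHom_apply,
        minpoly.aeval, map_zero]
  rw [← Polynomial.card_rootSet_eq_natDegree (K := AlgebraicClosure F)
    (IsGalois.separable F ζ) (IsAlgClosed.splits _), ← Nat.card_eq_fintype_card, hset]
  rw [Finset.coe_sort_coe, Nat.card_eq_fintype_card, Fintype.card_coe,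
    Finset.card_image_of_injOn (rootOfUnity_pow_residueCard_pow_injOn p hn hζ), Finset.card_range]

lemma finrank_unramifiedExt {n : ℕ} (hn : 0 < n) : Module.finrank F (unramifiedExt p F n) = n := by
  obtain ⟨ζ, hζ⟩ := exists_isPrimitiveRoot p (F := F) hn
  rw [unramifiedExt_eq_adjoin p hn hζ,
    IntermediateField.adjoin.finrank (Algebra.IsIntegral.isIntegral ζ),
    natDegree_minpoly_rootOfUnity p hn hζ]

/-- A polynomial of degree less than `n` over `F` with integral coefficients, one of which is `1`,
takes unit values at primitive roots of unity of order `q ^ n - 1`. -/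
lemma absVal_aeval_rootOfUnity {n : ℕ} (hn : 0 < n) {ζ : AlgebraicClosure F}
    (hζ : IsPrimitiveRoot ζ (residueCard p F ^ n - 1)) {R : Polynomial F}
    (hdeg : R.natDegree < n) (hint : ∀ i, absVal p F (R.coeff i) ≤ 1) {j : ℕ} (hj : R.coeff j = 1) :
    absVal p (AlgebraicClosure F) (Polynomial.aeval ζ R) = 1 := by
  classical
  have hm := residueCard_pow_sub_one_ne_zero p (F := F) hn
  obtain ⟨S, hS⟩ : R.map (algebraMap F (AlgebraicClosure F)) ∈
      Polynomial.lifts (integers p (AlgebraicClosure F)).subtype := by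
    rw [Polynomial.lifts_iff_coeff_lifts]
    intro i
    rw [Polynomial.coeff_map]
    exact ⟨⟨_, (absVal_algebraMap (R.coeff i)).trans_le (hint i)⟩, rfl⟩
  have hS' : S.map (integers p (AlgebraicClosure F)).subtype =
    R.map (algebraMap F (AlgebraicClosure F)) := hS
  have hcoeff (i) : (S.coeff i : AlgebraicClosure F) = algebraMap F _ (R.coeff i) := by
    rw [← Polynomial.coeff_map, ← hS', Polynomial.coeff_map]
    rfl
  let z : integers p (AlgebraicClosure F) :=
    ⟨ζ, mem_integers_of_pow_eq_one p hm hζ.pow_eq_one⟩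
  have hz : ((S.eval z : integers p (AlgebraicClosure F)) : AlgebraicClosure F) =
      Polynomial.aeval ζ R := by
    rw [← Polynomial.eval_map_algebraMap, ← hS']
    exact (Polynomial.eval_map_apply (integers p (AlgebraicClosure F)).subtype z).symm
  rw [← hz]
  by_contra hne
  have hlt : absVal p (AlgebraicClosure F) (S.eval z : integers p (AlgebraicClosure F)) < 1 :=
    lt_of_le_of_ne (S.eval z).2 hne
  rw [← residue_eq_zero_iff, ← Polynomial.eval_map_apply] at hlt
  set T := S.map (IsLocalRing.residue (integers p (AlgebraicClosure F))) with hT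
  have hroot (i : ℕ) :
      T.eval (IsLocalRing.residue _ z ^ residueCard p F ^ i) = 0 := by
    induction i with
    | zero => simpa using hlt
    | succ i ih =>
      rw [pow_succ, pow_mul]
      exact eval_pow_residueCard_eq_zero p (fun i => ⟨_, (hcoeff i).symm⟩) ih
  -- The reduction has degree below `n` but vanishes at the `n` distinct Frobenius conjugates of the
  -- class of `ζ`.
  have hT0 : T = 0 := by
    refine Polynomial.eq_zero_of_natDegree_lt_card_of_eval_eq_zero' T
      ((Finset.range n).image fun i => IsLocalRing.residue _ z ^ residueCard p F ^ i) ?_ ?_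
    · intro c hc
      obtain ⟨i, -, rfl⟩ := Finset.mem_image.1 hc
      exact hroot i
    · rw [Finset.card_image_of_injOn, Finset.card_range]
      · refine lt_of_le_of_lt ?_ hdeg
        rw [Polynomial.natDegree_le_iff_coeff_eq_zero]
        intro i hi
        have h0 : S.coeff i = 0 := Subtype.ext (by
          rw [hcoeff, Polynomial.coeff_eq_zero_of_natDegree_lt hi, map_zero]; rfl)
        rw [hT, Polynomial.coeff_map, h0, map_zero]
      · intro i hi k hk h
        refine rootOfUnity_pow_residueCard_pow_injOn p hn hζ hi hk ?_
        simp only [← map_pow] at h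
        rw [residue_eq_iff] at h
        refine eq_of_absVal_sub_lt p hn ?_ ?_ h <;>
          rw [← pow_mul, mul_comm, pow_mul, hζ.pow_eq_one, one_pow]
  have h1 : T.coeff j = 1 := by
    have : S.coeff j = 1 := Subtype.ext (by rw [hcoeff, hj, map_one]; rfl)
    rw [hT, Polynomial.coeff_map, this, map_one]
  rw [hT0, Polynomial.coeff_zero] at h1
  exact zero_ne_one h1

/-- Write `x` as a polynomial in `ζ` of degree below `n`. Dividing by a coefficient of largest
absolute value leaves a unit, so `x` has the absolute value of that coefficient. -/
lemma isUnramified_unramifiedExt {n : ℕ} (hn : 0 < n) : IsUnramified p (unramifiedExt p F n) := by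
  refine ⟨finiteDimensional_unramifiedExt p hn, fun x hx => ?_⟩
  by_cases hx0 : x = 0
  · exact ⟨0, by rw [hx0, map_zero, map_zero, map_zero]⟩
  obtain ⟨ζ, hζ⟩ := exists_isPrimitiveRoot p (F := F) hn
  have hint : IsIntegral F ζ := Algebra.IsIntegral.isIntegral ζ
  rw [unramifiedExt_eq_adjoin p hn hζ, ← IntermediateField.mem_toSubalgebra,
    IntermediateField.adjoin_simple_toSubalgebra_of_isAlgebraic hint.isAlgebraic,
    Algebra.adjoin_singleton_eq_range_aeval] at hx
  obtain ⟨P, rfl⟩ := hx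
  change Polynomial.aeval ζ P ≠ 0 at hx0
  change ∃ y, absVal p _ (Polynomial.aeval ζ P) = _
  have hmonic := minpoly.monic hint
  rw [← Polynomial.aeval_modByMonic_eq_self_of_root (minpoly.aeval F ζ)] at hx0 ⊢
  set R := P %ₘ minpoly F ζ with hR
  have hdeg : R.natDegree < n := by
    refine (Polynomial.natDegree_modByMonic_lt P hmonic (minpoly.ne_one F ζ)).trans_eq ?_
    exact natDegree_minpoly_rootOfUnity p hn hζ
  obtain ⟨j, -, hj⟩ := (Finset.range n).exists_max_image (fun i => absVal p F (R.coeff i))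
    ⟨0, Finset.mem_range.2 hn⟩
  have hj' (i) : absVal p F (R.coeff i) ≤ absVal p F (R.coeff j) := by
    by_cases hi : i < n
    · exact hj i (Finset.mem_range.2 hi)
    · rw [Polynomial.coeff_eq_zero_of_natDegree_lt (by omega), map_zero]
      exact zero_le
  have ha : R.coeff j ≠ 0 := fun h0 => hx0 (by
    have : R = 0 := by
      ext i
      have := hj' i
      rw [h0, map_zero, nonpos_iff_eq_zero, map_eq_zero] at this
      rw [this, Polynomial.coeff_zero]
    rw [this, map_zero])
  refine ⟨R.coeff j, ?_⟩
  have h1 := absVal_aeval_rootOfUnity p hn hζ (R := Polynomial.C (R.coeff j)⁻¹ * R)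
    ((Polynomial.natDegree_C_mul_le _ _).trans_lt hdeg) (fun i => ?_) (j := j) ?_
  · rw [map_mul, Polynomial.aeval_C, map_mul, map_inv₀, map_inv₀] at h1
    exact ((inv_mul_eq_one₀ (by simpa using ha)).1 h1).symm
  · rw [Polynomial.coeff_C_mul, map_mul, map_inv₀]
    exact inv_mul_le_one_of_le₀ (hj' i) zero_le
  · rw [Polynomial.coeff_C_mul, inv_mul_cancel₀ ha]

/-- Some element of `E` is congruent to `ζ`. An automorphism fixing `E` thus sends `ζ` to a
congruent root of unity, namely `ζ` itself, and Galois theory applies. -/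
lemma mem_of_pow_card_residueField_sub_one_eq_one (E : IntermediateField F (AlgebraicClosure F))
    [FiniteDimensional ℚ_[p] E] {n : ℕ} (hn : 0 < n)
    (hcard : Nat.card (residueField p E) = residueCard p F ^ n) {ζ : AlgebraicClosure F}
    (hζ : ζ ^ (residueCard p F ^ n - 1) = 1) : ζ ∈ E := by
  have := isGalois_algebraicClosure p F
  rw [← InfiniteGalois.fixedField_fixingSubgroup E, IntermediateField.mem_fixedField_iff]
  intro g hg
  let z : integers p (AlgebraicClosure F) :=
    ⟨ζ, mem_integers_of_pow_eq_one p (residueCard_pow_sub_one_ne_zero p hn) hζ⟩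
  have hz : IsLocalRing.residue _ z ^ Nat.card (residueField p E) = IsLocalRing.residue _ z := by
    have h1 : z ^ (residueCard p F ^ n - 1) = 1 := Subtype.ext hζ
    have h2 : residueCard p F ^ n = residueCard p F ^ n - 1 + 1 := by
      have := residueCard_pow_sub_one_ne_zero p (F := F) hn
      omega
    rw [hcard, h2, ← map_pow, pow_succ, h1, one_mul]
  obtain ⟨y, hy⟩ := exists_residueFieldMap_eq p E hz
  obtain ⟨x, rfl⟩ := IsLocalRing.residue_surjective y
  have h1 : absVal p (AlgebraicClosure F) (((x : E) : AlgebraicClosure F) - ζ) < 1 :=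
    (residue_eq_iff ⟨((x : E) : AlgebraicClosure F), _⟩ z).1 hy
  have h2 := h1
  rw [← absVal_apply_aut p g, map_sub,
    (IntermediateField.mem_fixingSubgroup_iff _ _).1 hg _ (x : E).2, Valuation.map_sub_swap] at h2
  have h3 := Valuation.map_add_lt _ h2 h1
  rw [sub_add_sub_cancel] at h3
  exact eq_of_absVal_sub_lt p hn (by rw [← map_pow, hζ, map_one]) hζ h3

/-- Finite unramified extensions are generated by roots of unity. -/
lemma IsUnramified.exists_eq_unramifiedExt {E : IntermediateField F (AlgebraicClosure F)}
    (hE : IsUnramified p E) : ∃ n, 0 < n ∧ E = unramifiedExt p F n := by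
  obtain ⟨hfin, hval⟩ := hE
  have := finiteDimensional_intermediateField p E
  obtain ⟨n, hn, hcard⟩ := exists_card_residueField_eq_pow p F E
  have hmem {ζ : AlgebraicClosure F} (hζ : ζ ^ (residueCard p F ^ n - 1) = 1) : ζ ∈ E :=
    mem_of_pow_card_residueField_sub_one_eq_one p E hn hcard hζ
  refine ⟨n, hn, le_antisymm (fun x hx => ?_)
    (IntermediateField.adjoin_le_iff.2 fun ζ hζ => hmem hζ)⟩
  let S : Submodule ℚ_[p] E :=
    ((Subalgebra.toSubmodule (unramifiedExt p F n).toSubalgebra).comap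
      E.val.toLinearMap).restrictScalars ℚ_[p]
  -- If `x ≠ y`, an element of `F` rescales `x - y` to a unit because `E` is unramified. A root of
  -- unity in the same residue class then gives a strictly better approximation.
  obtain ⟨y, hyS, hy⟩ := exists_best_approximation S ⟨x, hx⟩
  have hyU : (y : AlgebraicClosure F) ∈ unramifiedExt p F n := hyS
  by_cases hxy : x = y
  · rwa [hxy]
  exfalso
  have hw0 : x - y ≠ 0 := sub_ne_zero.2 hxy
  obtain ⟨z, hz⟩ := hval _ (sub_mem hx y.2)
  have hvz : absVal p (AlgebraicClosure F) (algebraMap F _ z) ≠ 0 := by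
    rw [← hz]
    exact (Valuation.ne_zero_iff _).2 hw0
  have hz0 : algebraMap F (AlgebraicClosure F) z ≠ 0 := (Valuation.ne_zero_iff _).1 hvz
  let u : E := (⟨x, hx⟩ - y) / algebraMap F E z
  have hu : (u : AlgebraicClosure F) = (x - y) / algebraMap F _ z := rfl
  have hu1 : absVal p (AlgebraicClosure F) u = 1 := by
    rw [hu, map_div₀, hz, div_self hvz]
  have h1 := absVal_pow_card_sub_one (p := p) u
    (by rw [← absVal_algebraMap (L' := AlgebraicClosure F)]; exact hu1)
  rw [hcard, ← absVal_algebraMap (L' := AlgebraicClosure F), map_sub, map_pow, map_one] at h1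
  obtain ⟨ζ, hζ, hlt⟩ := exists_rootOfUnity_near p hn h1
  have h2 := hy (y + algebraMap F E z * ⟨ζ, hmem hζ⟩) (by
    change (y : AlgebraicClosure F) + algebraMap F _ z * ζ ∈ unramifiedExt p F n
    exact add_mem hyU (mul_mem (IntermediateField.algebraMap_mem _ z) (mem_unramifiedExt p hζ)))
  rw [← absVal_algebraMap (L := E) (L' := AlgebraicClosure F),
    ← absVal_algebraMap (L := E) (L' := AlgebraicClosure F)] at h2
  change absVal p (AlgebraicClosure F) (x - y) ≤
    absVal p (AlgebraicClosure F) (x - (y + algebraMap F _ z * ζ)) at h2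
  have h3 : x - (y + algebraMap F (AlgebraicClosure F) z * ζ) = algebraMap F _ z * (u - ζ) := by
    rw [hu]
    field_simp
    ring
  rw [h3, map_mul, hz] at h2
  exact absurd h2 (not_le.2 (mul_lt_of_lt_one_right (pos_iff_ne_zero.2 hvz) hlt))

end UnramifiedExt

/-! ### The degree map of the Weil group. -/

section Degree

variable (p : ℕ) [Fact p.Prime] (F : Type*) [Field F] [Algebra ℚ_[p] F] [FiniteDimensional ℚ_[p] F]

lemma mem_weilInertia_iff {w : weilGroup p F} :
    w ∈ weilInertia p F ↔ ActsAsFrobPow p (w : AbsGal F) 0 :=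
  Subgroup.mem_subgroupOf.trans (actsAsFrobPow_zero_iff p).symm

lemma exists_isGeomFrob : ∃ Φ : weilGroup p F, IsGeomFrob Φ := by
  obtain ⟨φ, hφ⟩ := exists_actsAsFrobPow_one p F
  refine ⟨⟨φ⁻¹, inv_mem ⟨1, Or.inl hφ⟩⟩, ?_⟩
  change ActsAsFrobPow p (φ⁻¹)⁻¹ 1
  rwa [inv_inv]

variable {p F}

lemma IsGeomFrob.mul_pow_mem {Φ w : weilGroup p F} (hΦ : IsGeomFrob Φ) {n : ℕ}
    (hw : ActsAsFrobPow p (w : AbsGal F) n) : w * Φ ^ n ∈ weilInertia p F := by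
  rw [mem_weilInertia_iff]
  have := hw.mul_inv (hΦ.pow n) le_rfl
  rwa [Nat.sub_self, inv_pow, inv_inv] at this

lemma IsGeomFrob.pow_mem_weilInertia_iff {Φ : weilGroup p F} (hΦ : IsGeomFrob Φ) {n : ℕ} :
    Φ ^ n ∈ weilInertia p F ↔ n = 0 := by
  refine ⟨fun h => ?_, fun h => by rw [h, pow_zero]; exact one_mem _⟩
  -- At level `n + 1`, fixing `ζ` forces `n + 1` to divide `n`, hence `n = 0`.
  obtain ⟨ζ, hζ⟩ := exists_isPrimitiveRoot p (F := F) n.succ_pos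
  rw [← inv_mem_iff, mem_weilInertia_iff] at h
  have h1 := h.apply_rootOfUnity n.succ_pos hζ.pow_eq_one
  have h2 := (hΦ.pow n).apply_rootOfUnity n.succ_pos hζ.pow_eq_one
  rw [Subgroup.coe_inv, Subgroup.coe_pow, ← inv_pow, h2, pow_zero, pow_one,
    rootOfUnity_pow_residueCard_pow_eq_iff p n.succ_pos hζ] at h1
  exact Nat.eq_zero_of_dvd_of_lt h1 n.lt_succ_self

lemma IsGeomFrob.zpowersHom_bijective {Φ : weilGroup p F} (hΦ : IsGeomFrob Φ) :
    Function.Bijective (zpowersHom _ (Φ : weilGroup p F ⧸ weilInertia p F)) := by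
  constructor
  · rw [injective_iff_map_eq_one]
    intro m hm
    rw [zpowersHom_apply, ← QuotientGroup.mk_zpow, QuotientGroup.eq_one_iff] at hm
    have h1 : Φ ^ m.toAdd.natAbs ∈ weilInertia p F := by
      rcases Int.natAbs_eq m.toAdd with h | h
      · rwa [h, zpow_natCast] at hm
      · rwa [h, zpow_neg, zpow_natCast, inv_mem_iff] at hm
    exact Multiplicative.toAdd.injective
      (Int.natAbs_eq_zero.1 (hΦ.pow_mem_weilInertia_iff.1 h1))
  · intro x
    obtain ⟨w, rfl⟩ := QuotientGroup.mk_surjective x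
    have key {u : weilGroup p F} {n : ℕ} (hu : ActsAsFrobPow p (u : AbsGal F) n) :
        (Φ : weilGroup p F ⧸ weilInertia p F) ^ n = (u : weilGroup p F ⧸ weilInertia p F)⁻¹ := by
      have := (QuotientGroup.eq_one_iff _).2 (hΦ.mul_pow_mem hu)
      rw [QuotientGroup.mk_mul, QuotientGroup.mk_pow] at this
      exact (inv_eq_of_mul_eq_one_right this).symm
    obtain ⟨n, hn | hn⟩ := w.2
    · refine ⟨Multiplicative.ofAdd (-(n : ℤ)), ?_⟩
      rw [zpowersHom_apply, toAdd_ofAdd, zpow_neg, zpow_natCast, key hn, inv_inv]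
    · refine ⟨Multiplicative.ofAdd (n : ℤ), ?_⟩
      rw [zpowersHom_apply, toAdd_ofAdd, zpow_natCast, key (u := w⁻¹) hn, QuotientGroup.mk_inv,
        inv_inv]

lemma IsGeomFrob.mk_eq {Φ Φ' : weilGroup p F} (hΦ : IsGeomFrob Φ) (hΦ' : IsGeomFrob Φ') :
    (Φ : weilGroup p F ⧸ weilInertia p F) = Φ' := by
  rw [QuotientGroup.eq, mem_weilInertia_iff]
  have := ActsAsFrobPow.mul_inv hΦ hΦ' le_rfl
  rwa [inv_inv] at this

variable (p F)

/-- The degree map of the Weil group, normalised so that geometric Frobenius elements have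
degree one. -/
def weilDegree : weilGroup p F →* Multiplicative ℤ :=
  (MulEquiv.ofBijective _
    (exists_isGeomFrob p F).choose_spec.zpowersHom_bijective).symm.toMonoidHom.comp
      (QuotientGroup.mk' (weilInertia p F))

variable {p F}

lemma mem_weilInertia_iff_weilDegree (g : weilGroup p F) :
    g ∈ weilInertia p F ↔ weilDegree p F g = 1 := by
  rw [weilDegree, MonoidHom.comp_apply, MulEquiv.coe_toMonoidHom, MulEquiv.map_eq_one_iff]
  exact (QuotientGroup.eq_one_iff g).symm

lemma IsGeomFrob.weilDegree_eq {Φ : weilGroup p F} (hΦ : IsGeomFrob Φ) :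
    weilDegree p F Φ = Multiplicative.ofAdd 1 := by
  rw [weilDegree, MonoidHom.comp_apply, MulEquiv.coe_toMonoidHom, MulEquiv.symm_apply_eq,
    MulEquiv.ofBijective_apply, zpowersHom_apply, toAdd_ofAdd, zpow_one]
  exact hΦ.mk_eq (exists_isGeomFrob p F).choose_spec

lemma actsAsFrobPow_of_weilDegree {g : weilGroup p F} {n : ℕ}
    (hg : weilDegree p F g = Multiplicative.ofAdd (-(n : ℤ))) :
    ActsAsFrobPow p (g : AbsGal F) n := by
  obtain ⟨Φ, hΦ⟩ := exists_isGeomFrob p F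
  have h1 : Φ ^ n * g ∈ weilInertia p F := by
    rw [mem_weilInertia_iff_weilDegree, map_mul, map_pow, hΦ.weilDegree_eq, hg, ← ofAdd_nsmul,
      ← ofAdd_add]
    simp
  have h2 := (hΦ.pow n).mul ((mem_weilInertia_iff p F).1 h1)
  rw [zero_add, Subgroup.coe_mul, Subgroup.coe_pow, inv_pow, inv_mul_cancel_left] at h2
  exact h2

lemma mem_weilSubgroup_unramifiedExt_iff {n : ℕ} (hn : 0 < n) (g : weilGroup p F) :
    g ∈ weilSubgroup p (unramifiedExt p F n) ↔ (n : ℤ) ∣ (weilDegree p F g).toAdd := by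
  obtain ⟨ζ, hζ⟩ := exists_isPrimitiveRoot p (F := F) hn
  have key {u : weilGroup p F} {m : ℕ}
      (hu : weilDegree p F u = Multiplicative.ofAdd (-(m : ℤ))) :
      u ∈ weilSubgroup p (unramifiedExt p F n) ↔ n ∣ m := by
    rw [weilSubgroup, Subgroup.mem_subgroupOf, mem_fixingSubgroup_unramifiedExt_iff p hn hζ,
      (actsAsFrobPow_of_weilDegree hu).apply_rootOfUnity hn hζ.pow_eq_one,
      rootOfUnity_pow_residueCard_pow_eq_iff p hn hζ]
  rw [← Int.dvd_natAbs, Int.natCast_dvd_natCast]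
  -- The action on roots of unity is explicit only in nonpositive degree, so an element of positive
  -- degree is replaced by its inverse.
  rcases Int.natAbs_eq (weilDegree p F g).toAdd with h | h
  · rw [← inv_mem_iff]
    refine key ?_
    rw [map_inv, ← h]
    rfl
  · refine key ?_
    rw [← h]
    rfl

end Degree

/-! ### Stable subspaces as representations in coordinates. -/

section Restriction

variable {G : Type*} [Group G] {V : Type*} [AddCommGroup V] [Module ℂ V] [FiniteDimensional ℂ V]
  {ρ : Representation ℂ G V}

/-- An invariant subspace for a subgroup, in coordinates. -/
lemma exists_representation_of_invariant (H : Subgroup G) (U : Submodule ℂ V)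
    (hU : ∀ h : H, ∀ v ∈ U, ρ h v ∈ U) :
    ∃ (n : ℕ) (σ : Representation ℂ H (Fin n → ℂ)) (ι : (Fin n → ℂ) →ₗ[ℂ] V),
      Function.Injective ι ∧ LinearMap.range ι = U ∧ ∀ h x, ι (σ h x) = ρ h (ι x) := by
  let ψ := (Module.finBasis ℂ U).equivFun
  let ι := U.subtype ∘ₗ ψ.symm.toLinearMap
  have hι : Function.Injective ι := U.injective_subtype.comp ψ.symm.injective
  let f (h : H) : Module.End ℂ (Fin (Module.finrank ℂ U) → ℂ) :=
    ψ.toLinearMap ∘ₗ (ρ h).restrict (hU h) ∘ₗ ψ.symm.toLinearMap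
  have hf (h x) : ι (f h x) = ρ h (ι x) := by
    change ((ψ.symm (ψ _) : U) : V) = _
    rw [ψ.symm_apply_apply]
    rfl
  refine ⟨_, { toFun := f, map_one' := ?_, map_mul' := ?_ }, ι, hι, ?_, hf⟩
  · refine LinearMap.ext fun x => hι ?_
    rw [hf]
    simp
  · refine fun g h => LinearMap.ext fun x => hι ?_
    rw [hf, Module.End.mul_apply, hf, hf]
    simp
  · rw [LinearMap.range_comp_of_range_eq_top _ ψ.symm.range, Submodule.range_subtype]

end Restriction

/-! ### Parity of the order of a skew twist. -/

section Form

lemma even_of_form_anti {V : Type*} [AddCommGroup V] [Module ℂ V] [Nontrivial V]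
    {B : LinearMap.BilinForm ℂ V} (hB : B.Nondegenerate)
    {b : Module.End ℂ V} {d : ℕ} (hbd : b ^ d = 1) (hb : ∀ x y, B (b x) y = - B x (b y)) :
    Even d := by
  by_contra hodd
  rw [Nat.not_even_iff_odd] at hodd
  obtain ⟨x, hx⟩ := exists_ne (0 : V)
  refine hx (hB.1 x fun y => ?_)
  have h1 := form_pow_apply (ε := -1) (by simpa using hb) d x y
  rw [hbd, hodd.neg_one_pow, Module.End.one_apply, Module.End.one_apply, neg_one_mul] at h1
  exact self_eq_neg.1 h1

end Form

/-! ### Maximality of the inducing field and the computation of the L-factors. -/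

section Main

variable {p : ℕ} [Fact p.Prime] {F : Type*} [Field F] [Algebra ℚ_[p] F] [FiniteDimensional ℚ_[p] F]
  {V : Type*} [AddCommGroup V] [Module ℂ V] [FiniteDimensional ℂ V]
  {ρ : Representation ℂ (weilGroup p F) V}

/-- The inducing representation is the fixed space of `a`, stable under the subgroup on which the
character is trivial; smoothness is inherited from `ρ`. -/
lemma isInducedFrom_unramifiedExt (hsmooth : IsSmooth (weilTopology p F) ρ)
    (hirr : ρ.IsIrreducible) {t : ℕ} (ht : 0 < t) {z : ℂˣ} (hz : orderOf z = t)
    {a : Module.End ℂ V} (ha : IsTwist ρ (powChar (weilDegree p F) z) a) (hat : a ^ t = 1) :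
    IsInducedFrom p ρ (unramifiedExt p F t) := by
  have hH := mem_weilSubgroup_unramifiedExt_iff (p := p) (F := F) ht
  obtain ⟨Φ, hΦ⟩ := exists_isGeomFrob p F
  obtain ⟨n, σ, ι, hι, hιr, hισ⟩ := exists_representation_of_invariant (ρ := ρ)
    (weilSubgroup p (unramifiedExt p F t)) (LinearMap.eqLocus a LinearMap.id) fun h v hv => by
      have h1 := LinearMap.congr_fun (ha h) v
      rw [(powChar_eq_one_iff hz hH h).2 h.2, Units.val_one, one_smul, Module.End.mul_apply,
        Module.End.mul_apply, LinearMap.mem_eqLocus.1 hv] at h1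
      exact LinearMap.mem_eqLocus.2 h1.symm
  refine ⟨n, σ, fun v => ?_, equiv_ind_of_isTwist hirr hΦ.weilDegree_eq ht hz hH ha hat ι hι hισ
    fun v => ?_⟩
  · refine ⟨_, hsmooth (ι v), ?_⟩
    ext h
    rw [Set.mem_preimage, Set.mem_ofPred_eq, Set.mem_ofPred_eq, ← hισ, hι.eq_iff]
  · rw [hιr]
    exact LinearMap.mem_eqLocus

/-- A twist of order `t` divisible by `d` induces `ρ` from the unramified extension of degree `t`,
which contains the maximal one; comparing degrees gives `t = d`. -/
lemma IsMaximalInducing.isMaximalTwist (hsmooth : IsSmooth (weilTopology p F) ρ)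
    (hirr : ρ.IsIrreducible) {d : ℕ} (hd : 0 < d)
    (hE : IsMaximalInducing p ρ (unramifiedExt p F d)) :
    IsMaximalTwist ρ (weilDegree p F) d := fun t ht hdt z hz a ha hat => by
  have h := hE.2.2 _ (unramifiedExt_mono p hdt) (isUnramified_unramifiedExt p ht)
    (isInducedFrom_unramifiedExt hsmooth hirr ht hz ha hat)
  rw [← finrank_unramifiedExt p (F := F) ht, h, finrank_unramifiedExt p hd]

/-- The `L`-factor of a constituent `π` of `ρ ⊗ ρ` that is modelled by the skew-adjoint
endomorphisms with respect to an invariant form. -/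
theorem lFactor_of_isSkewModel (hirr : ρ.IsIrreducible) {d : ℕ} (hd : 0 < d)
    (hmax : IsMaximalTwist ρ (weilDegree p F) d)
    {W : Type*} [AddCommGroup W] [Module ℂ W] [FiniteDimensional ℂ W]
    {σ : Representation ℂ (weilSubgroup p (unramifiedExt p F d)) W}
    (e : ρ.Equiv (Representation.ind (weilSubgroup p (unramifiedExt p F d)).subtype σ))
    {B : LinearMap.BilinForm ℂ V} (hB : B.Nondegenerate)
    (hinv : ∀ g x y, B (ρ g x) (ρ g y) = B x y) {c : ℂ} (hc : c * c = 1)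
    (hsymm : ∀ x y, B y x = c * B x y) {P : Type*} [AddCommGroup P] [Module ℂ P]
    {π : Representation ℂ (weilGroup p F) P} {j : P →ₗ[ℂ] Module.End ℂ V}
    (hj : IsSkewModel ρ B π j) :
    (IsSelfDual σ → ∀ Φ : weilGroup p F, IsGeomFrob Φ → ∀ s : ℂ, lFactor p Φ π s = 1) ∧
    (¬ IsSelfDual σ → ∃ e : ℕ, d = 2 * e ∧
      ∀ Φ : weilGroup p F, IsGeomFrob Φ → ∀ s : ℂ,
        lFactor p Φ π s = (1 + (residueCard p F : ℂ) ^ (-(e : ℂ) * s))⁻¹) := by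
  have := IsIrreducible.nontrivial hirr
  obtain ⟨Φ₀, hΦ₀⟩ := exists_isGeomFrob p F
  have hH := mem_weilSubgroup_unramifiedExt_iff (p := p) (F := F) hd
  obtain ⟨w, hw⟩ : ∃ w : ℂˣ, orderOf w = d := by
    have h := Complex.isPrimitiveRoot_exp d hd.ne'
    exact ⟨(h.isUnit hd.ne').unit, (h.isUnit_unit hd.ne').eq_orderOf.symm⟩
  let D : InducingData ρ σ (weilDegree p F) w d := inducingDataOfEquiv hw hH e
  have hb : IsUnit D.twist := IsUnit.of_pow_eq_one D.twist_pow hd.ne'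
  have hspan := kerCommutant_le_span hirr hΦ₀.weilDegree_eq hmax hd hw D.isTwist D.twist_pow
  -- The sign decides both the L-factor and the self-duality of `σ`, so in each case one of the two
  -- implications is vacuous.
  obtain ⟨ε, rfl | rfl, hε⟩ := D.isTwist.exists_sign hirr hB hinv hc hsymm hb.ne_zero
  · simp only [one_mul] at hε
    refine ⟨fun _ Φ _ s => ?_, fun h => absurd (D.isSelfDual hd hB hinv hε) h⟩
    rw [lFactor, hj.det_eq_one mem_weilInertia_iff_weilDegree hB hε hspan, inv_one]
  · simp only [neg_one_mul] at hε
    refine ⟨fun h => absurd h (D.not_isSelfDual hd hw hΦ₀.weilDegree_eq (fun g hg => ?_) hB hinv hε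
      hspan), fun _ => ?_⟩
    · rw [hH, hg, toAdd_one]
      exact dvd_zero _
    · obtain ⟨e, he⟩ := (even_of_form_anti hB D.twist_pow hε).exists_two_nsmul
      rw [smul_eq_mul] at he
      refine ⟨e, he, fun Φ hΦ s => ?_⟩
      rw [lFactor, hj.det_eq_one_add_pow mem_weilInertia_iff_weilDegree hB hε hb D.isTwist
        (by omega) he hw hspan hΦ.weilDegree_eq, ← Complex.cpow_nat_mul, neg_mul, mul_neg]

end Main

end WeilRep

end

theorem mainTheorem11 (p : ℕ) [Fact p.Prime]
    (F : Type*) [Field F] [Algebra ℚ_[p] F] [FiniteDimensional ℚ_[p] F]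
    {V : Type*} [AddCommGroup V] [Module ℂ V] [FiniteDimensional ℂ V]
    (ρ : Representation ℂ (WeilRep.weilGroup p F) V)
    (hsmooth : WeilRep.IsSmooth (WeilRep.weilTopology p F) ρ)
    (hirr : ρ.IsIrreducible)
    (hdual : WeilRep.IsSelfDual ρ)
    (E : IntermediateField F (AlgebraicClosure F))
    (hE : WeilRep.IsMaximalInducing p ρ E)
    {W : Type*} [AddCommGroup W] [Module ℂ W] [FiniteDimensional ℂ W]
    (σ : Representation ℂ (WeilRep.weilSubgroup p E) W)
    (hσ : WeilRep.IsSmooth (WeilRep.weilSubgroupTopology p E) σ)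
    (hind : Nonempty (ρ.Equiv (Representation.ind (WeilRep.weilSubgroup p E).subtype σ))) :
    (WeilRep.IsOrthogonal ρ →
      (WeilRep.IsSelfDual σ →
        ∀ Φ : WeilRep.weilGroup p F, WeilRep.IsGeomFrob Φ → ∀ s : ℂ,
          WeilRep.lFactor p Φ (WeilRep.extSq ρ) s = 1) ∧
      (¬ WeilRep.IsSelfDual σ →
        ∃ e : ℕ, Module.finrank F E = 2 * e ∧
          ∀ Φ : WeilRep.weilGroup p F, WeilRep.IsGeomFrob Φ → ∀ s : ℂ,
            WeilRep.lFactor p Φ (WeilRep.extSq ρ) s =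
              (1 + (WeilRep.residueCard p F : ℂ) ^ (-(e : ℂ) * s))⁻¹)) ∧
    (WeilRep.IsSymplectic ρ →
      (WeilRep.IsSelfDual σ →
        ∀ Φ : WeilRep.weilGroup p F, WeilRep.IsGeomFrob Φ → ∀ s : ℂ,
          WeilRep.lFactor p Φ (WeilRep.symSq ρ) s = 1) ∧
      (¬ WeilRep.IsSelfDual σ →
        ∃ e : ℕ, Module.finrank F E = 2 * e ∧
          ∀ Φ : WeilRep.weilGroup p F, WeilRep.IsGeomFrob Φ → ∀ s : ℂ,
            WeilRep.lFactor p Φ (WeilRep.symSq ρ) s =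
              (1 + (WeilRep.residueCard p F : ℂ) ^ (-(e : ℂ) * s))⁻¹)) := by
  obtain ⟨d, hd, rfl⟩ := hE.1.exists_eq_unramifiedExt
  obtain ⟨e⟩ := hind
  have hmax := hE.isMaximalTwist hsmooth hirr hd
  rw [WeilRep.finrank_unramifiedExt p hd]
  constructor
  · rintro ⟨B, hB, hsymm, hinv⟩
    obtain ⟨j, hj⟩ := WeilRep.exists_isSkewModel_extSq hB hinv hsymm
    exact WeilRep.lFactor_of_isSkewModel hirr hd hmax e hB hinv (c := 1) (one_mul 1)
      (fun x y => by rw [one_mul, hsymm]) hj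
  · rintro ⟨B, hB, halt, hinv⟩
    have hskew (x y) : B x y = - B y x := (LinearMap.IsAlt.neg (B := B) halt y x).symm
    obtain ⟨j, hj⟩ := WeilRep.exists_isSkewModel_symSq hB hinv hskew
    exact WeilRep.lFactor_of_isSkewModel hirr hd hmax e hB hinv (c := -1) (by norm_num)
      (fun x y => by rw [neg_one_mul, ← hskew]) hj
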